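/- Let $\zeta\in C^\infty([0,\infty))$ be a fixed cut-off function with $\zeta=1$ on $[0,\frac18]$ and $\zeta=0$ on $[\frac14,\infty)$. For an integer $k\ge 1$, $\epsilon\in[0,1]$ and a real-valued $f\in C_c^\infty([0,\infty))$ (smooth up to $x=0$, vanishing for large $x$), let $\mathcal P_f(x)=\sum_{m=0}^{3k-1}\frac{f^{(m)}(0)}{m!}x^m$, let $\|\mathcal P_f\|$ be the $\ell^2$-norm of its coefficients, let $f_0=f-\zeta\mathcal P_f$, and set $$\|f\|_{X^k_\epsilon}=\|\mathcal P_f\|+\|f_0\|_{L^2(0,\infty)}+[f_0]_{X^k_\epsilon},\qquad [f_0]_{X^k_\epsilon}=\Big(\frac1{2\pi}\int_{\mathbb R}\big(|\lambda|^{3k+1}\mu^k|\widehat{f_0}(\lambda)|\big)^2\Big|_{\lambda=3k-\frac12+is}\,ds\Big)^{1/2},$$ where $\widehat{f_0}(\lambda)=\int_0^\infty x^{-\lambda}f_0(x)\,\frac{dx}{x}$ is the Mellin transform and $\mu=\min\{|\lambda|,\frac1\epsilon\}$ (with $\frac10=\infty$). Let $X^k_\epsilon$ be the completion of $C_c^\infty([0,\infty))$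 with respect to this norm, viewed as a space of functions in $L^2(0,\infty)$. Then for every integer $k\ge1$ there is a constant $C$, depending only on $k$ (and on the fixed cut-off $\zeta$) but not on $\epsilon$, such that for all $\epsilon\in[0,1]$ and all $f,g\in X^k_\epsilon$ the pointwise product satisfies $fg\in X^k_\epsilon$ and $$\|fg\|_{X^k_\epsilon}\le C\,\|f\|_{X^k_\epsilon}\,\|g\|_{X^k_\epsilon}.$$ -/

import Mathlib

open MeasureTheory Set Filter Topology
open scoped ENNReal NNReal ContDiff

namespace WeightedX

/-- A cut-off function on `[0, ∞)`: smooth up to `0`, equal to `1` on `[0, 1/8]` and to `0` on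
`[1/4, ∞)`. (Values at negative arguments are irrelevant, here and for all functions below.) -/
structure IsCutoff (ζ : ℝ → ℝ) : Prop where
  smooth : ContDiffOn ℝ ∞ ζ (Ici 0)
  eq_one : ∀ x ∈ Icc (0 : ℝ) (1 / 8), ζ x = 1
  eq_zero : ∀ x ∈ Ici (1 / 4 : ℝ), ζ x = 0

/-- `f ∈ C_c^∞([0, ∞))`: smooth up to the boundary point `0`, vanishing for large `x`. -/
structure IsTest (f : ℝ → ℝ) : Prop where
  smooth : ContDiffOn ℝ ∞ f (Ici 0)
  eventually_zero : ∃ R : ℝ, ∀ x, R ≤ x → f x = 0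

/-- The Taylor coefficient `f^(m)(0) / m!` of a function on `[0, ∞)`. -/
noncomputable def taylorCoeff (f : ℝ → ℝ) (m : ℕ) : ℝ :=
  iteratedDerivWithin m f (Ici 0) 0 / (m.factorial : ℝ)

/-- The Taylor polynomial at `0` of order `n_k = 3k - 1`, the largest integer smaller than
`3k - 1/2`; it is `0` if `k = 0`. -/
noncomputable def taylorPoly (k : ℕ) (f : ℝ → ℝ) (x : ℝ) : ℝ :=
  ∑ m ∈ Finset.range (3 * k), taylorCoeff f m * x ^ m

/-- The `ℓ²`-norm of the coefficients of the Taylor polynomial. -/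
noncomputable def polyNorm (k : ℕ) (f : ℝ → ℝ) : ℝ :=
  √(∑ m ∈ Finset.range (3 * k), taylorCoeff f m ^ 2)

/-- The remainder `f₀ = f - ζ P_f`. -/
noncomputable def remainder (k : ℕ) (ζ f : ℝ → ℝ) (x : ℝ) : ℝ :=
  f x - ζ x * taylorPoly k f x

/-- The Mellin transform in the normalization `∫₀^∞ x^(-l) f(x) dx/x`. -/
noncomputable def mellinHat (f : ℝ → ℝ) (l : ℂ) : ℂ :=
  mellin (fun x => (f x : ℂ)) (-l)

/-- `μ = min {|l|, 1/ε}`, where `1/ε = ∞` for `ε = 0`. -/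
noncomputable def mu (ε : ℝ) (l : ℂ) : ℝ :=
  if ε = 0 then ‖l‖ else min ‖l‖ (1 / ε)

/-- The point with imaginary part `s` on the line `Re l = 3k - 1/2`. -/
noncomputable def linePt (k : ℕ) (s : ℝ) : ℂ :=
  ⟨3 * (k : ℝ) - 1 / 2, s⟩

/-- The homogeneous norm `‖ |l|^(3k+1) μ^k f̂₀ ‖` in `L²(Re l = 3k - 1/2)`. The factor
`(2π)^(-1/2)` makes Plancherel's identity hold without a constant. -/
noncomputable def homNorm (k : ℕ) (ε : ℝ) (f₀ : ℝ → ℝ) : ℝ≥0∞ :=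
  ENNReal.ofReal (√(2 * Real.pi))⁻¹ *
    eLpNorm (fun s : ℝ =>
      ((‖linePt k s‖ ^ (3 * k + 1) * mu ε (linePt k s) ^ k : ℝ) : ℂ) *
        mellinHat f₀ (linePt k s)) 2 volume

/-- The norm `‖P_f‖ + ‖f₀‖_{L²(0,∞)} + [f₀]_k` on `C_c^∞([0, ∞))`. -/
noncomputable def testNorm (k : ℕ) (ε : ℝ) (ζ f : ℝ → ℝ) : ℝ≥0∞ :=
  ENNReal.ofReal (polyNorm k f)
    + eLpNorm (remainder k ζ f) 2 (volume.restrict (Ioi 0))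
    + homNorm k ε (remainder k ζ f)

/-- `φ` is a sequence in `C_c^∞([0, ∞))` which is Cauchy for `testNorm` and whose limit, as a
function on `(0, ∞)`, is `f`. -/
structure Approximates (k : ℕ) (ε : ℝ) (ζ : ℝ → ℝ) (φ : ℕ → ℝ → ℝ) (f : ℝ → ℝ) : Prop where
  test : ∀ n, IsTest (φ n)
  cauchy : ∀ δ : ℝ≥0∞, 0 < δ → ∃ N : ℕ, ∀ m ≥ N, ∀ n ≥ N,
    testNorm k ε ζ (fun x => φ m x - φ n x) ≤ δ
  tendsto : Tendsto
    (fun n => eLpNorm (fun x => φ n x - f x) 2 (volume.restrict (Ioi 0))) atTop (𝓝 0)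

/-- Membership in `X_ε^k`, the completion of `C_c^∞([0, ∞))` with respect to `testNorm`. Since
`testNorm` controls the norm of `L²(0, ∞)`, and a `testNorm`-Cauchy sequence which tends to `0` in
`L²(0, ∞)` also tends to `0` in `testNorm`, the completion is a space of (classes of)
functions in `L²(0, ∞)`. -/
def MemX (k : ℕ) (ε : ℝ) (ζ f : ℝ → ℝ) : Prop :=
  MemLp f 2 (volume.restrict (Ioi 0)) ∧ ∃ φ, Approximates k ε ζ φ f

/-- The norm of the completion `X_ε^k`: the limit of `testNorm` along approximating sequences. The
limit exists and is the same for all of them; the infimum serves only to avoid a choice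
(and gives `∞` outside the space). -/
noncomputable def XNorm (k : ℕ) (ε : ℝ) (ζ f : ℝ → ℝ) : ℝ≥0∞ :=
  ⨅ (φ : ℕ → ℝ → ℝ) (_ : Approximates k ε ζ φ f),
    limsup (fun n => testNorm k ε ζ (φ n)) atTop

end WeightedX

namespace WeightedX
open scoped SchwartzMap FourierTransform

section

/-! ### Integral inequalities -/

/-! Put `σ = 3k - 1/2` and `x = e^(-u)`. If `f` vanishes to order `3k` at the origin, its lift `F(u)
= e^(σu) f(e^(-u))` is a Schwartz function, the Mellin transform of `f` on the line is the Fourier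
transform of `F`, and the homogeneous seminorm squared is `∫ (w |𝓕 F|)²` (`wq`) with `w = |λ|^(3k+1)
μ^k`. The weight depends on `ε`, but only three properties of it matter, and they hold with one
constant for all `ε ∈ [0,1]` (`isWeight_mellinWeight`): quasi-subadditivity, polynomial
moderateness, and `w ≥ |ξ|^(3k)`.

The lift of `fg` is `e^(-σu) F G`. The factor `e^(-σu)` is unbounded as `u → -∞`, so the usual
convolution proof of an algebra property does not apply globally. The remedy is to localise: by
moderateness and Plancherel in the translation parameter, `wq w F` is comparable to the average over
`τ` of `wq w (χ(· - τ) F)` for a fixed window `χ`. On one window the exponential is the scalar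
`e^(-στ)` up to harmless factors. Quasi-subadditivity and Young's inequality bound the local product
by the weighted norm of one factor times the Wiener norm (`L¹` norm of the Fourier transform) of the
other. The scalar is absorbed by `exists_fourierL1_window_le`: an Agmon inequality at scale `R =
e^(-τ)` bounds `e^(-στ)` times the local Wiener norm by the `L²(0,∞)` norm and the seminorm,
uniformly in `τ`. Integrating in `τ` gives `exists_wq_mul_le`; the same bound yields the embedding
into bounded functions.

For general test functions, write `f = f₀ + ∑ aᵢ ζ xⁱ`. Products of `f₀` with `ζ xⁱ` are handled by
a multiplier estimate (`exists_wq_multiplier_le`), and the products `ζ xⁱ ζ xʲ` are finitely many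
fixed functions. The sup bound and the product inequality then pass to the completion. -/

theorem sq_lintegral_mul_le {α : Type*} [MeasurableSpace α] {μ : Measure α} {f g : α → ℝ≥0∞}
    (hf : AEMeasurable f μ) (hg : AEMeasurable g μ) :
    (∫⁻ x, f x * g x ∂μ) ^ 2 ≤ (∫⁻ x, f x ^ 2 ∂μ) * ∫⁻ x, g x ^ 2 ∂μ := by
  have h := ENNReal.lintegral_mul_le_Lp_mul_Lq μ Real.HolderConjugate.two_two hf hg
  have h2 := pow_le_pow_left' h 2
  simp only [Pi.mul_apply, ENNReal.rpow_ofNat] at h2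
  refine h2.trans (le_of_eq ?_)
  rw [mul_pow, ← ENNReal.rpow_natCast, ← ENNReal.rpow_natCast, ← ENNReal.rpow_mul,
    ← ENNReal.rpow_mul]
  norm_num

theorem sq_lintegral_mul_le_weighted {α : Type*} [MeasurableSpace α] {μ : Measure α}
    {f g : α → ℝ≥0∞} (hf : Measurable f) (hg : Measurable g) :
    (∫⁻ x, f x * g x ∂μ) ^ 2 ≤ (∫⁻ x, f x ^ 2 * g x ∂μ) * ∫⁻ x, g x ∂μ := by
  have h := sq_lintegral_mul_le (μ := μ.withDensity g) (f := f) (g := fun _ => 1)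
    hf.aemeasurable aemeasurable_const
  rw [lintegral_withDensity_eq_lintegral_mul _ hg (by fun_prop),
    lintegral_withDensity_eq_lintegral_mul _ hg (by fun_prop),
    lintegral_withDensity_eq_lintegral_mul _ hg (by fun_prop)] at h
  simpa [mul_comm] using h

/-- Cauchy–Schwarz with `b` as density in the inner integral, then Tonelli and translation
invariance. -/
theorem young_sq {a b : ℝ → ℝ≥0∞} (ha : Measurable a) (hb : Measurable b) :
    ∫⁻ x, (∫⁻ y, a (x - y) * b y) ^ 2 ≤ (∫⁻ x, a x ^ 2) * (∫⁻ x, b x) ^ 2 := by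
  calc ∫⁻ x, (∫⁻ y, a (x - y) * b y) ^ 2
      ≤ ∫⁻ x, (∫⁻ y, a (x - y) ^ 2 * b y) * ∫⁻ y, b y :=
        lintegral_mono fun x => sq_lintegral_mul_le_weighted (by fun_prop) hb
    _ = (∫⁻ x, ∫⁻ y, a (x - y) ^ 2 * b y) * ∫⁻ y, b y := by
        rw [lintegral_mul_const]
        exact Measurable.lintegral_prod_right' (f := fun p : ℝ × ℝ => a (p.1 - p.2) ^ 2 * b p.2)
          (by fun_prop)
    _ = (∫⁻ y, ∫⁻ x, a (x - y) ^ 2 * b y) * ∫⁻ y, b y := by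
        rw [lintegral_lintegral_swap]
        exact Measurable.aemeasurable (by fun_prop)
    _ = (∫⁻ x, a x ^ 2) * (∫⁻ x, b x) ^ 2 := by
        have : ∀ y, ∫⁻ x, a (x - y) ^ 2 * b y = (∫⁻ x, a x ^ 2) * b y := fun y => by
          rw [lintegral_mul_const _ (by fun_prop), lintegral_sub_right_eq_self (fun x => a x ^ 2) y]
        simp_rw [this]
        rw [lintegral_const_mul _ hb]
        ring

theorem lintegral_convolution_comm (a b : ℝ → ℝ≥0∞) (x : ℝ) :
    ∫⁻ y, a (x - y) * b y = ∫⁻ y, b (x - y) * a y := by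
  rw [← lintegral_sub_left_eq_self _ x]
  simp [mul_comm]

theorem young_sq' {a b : ℝ → ℝ≥0∞} (ha : Measurable a) (hb : Measurable b) :
    ∫⁻ x, (∫⁻ y, a (x - y) * b y) ^ 2 ≤ (∫⁻ x, a x) ^ 2 * (∫⁻ x, b x ^ 2) := by
  simp_rw [lintegral_convolution_comm a b]
  rw [mul_comm]
  exact young_sq hb ha

theorem add_sq_le_two_mul (a b : ℝ≥0∞) : (a + b) ^ 2 ≤ 2 * (a ^ 2 + b ^ 2) := by
  have h := ENNReal.rpow_add_le_mul_rpow_add_rpow a b (p := 2) (by norm_num)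
  norm_num at h
  exact_mod_cast h

/-! ### Schwartz functions on the line -/

/-- The pointwise product of Schwartz functions. -/
noncomputable def mulS (F G : 𝓢(ℝ, ℂ)) : 𝓢(ℝ, ℂ) :=
  SchwartzMap.pairing (ContinuousLinearMap.mul ℂ ℂ) F G

@[simp] theorem mulS_apply (F G : 𝓢(ℝ, ℂ)) (x : ℝ) : mulS F G x = F x * G x := rfl

/-- The translate `x ↦ F (x - τ)`. -/
noncomputable def shift (τ : ℝ) (F : 𝓢(ℝ, ℂ)) : 𝓢(ℝ, ℂ) :=
  SchwartzMap.compSubConstCLM ℂ τ F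

@[simp] theorem shift_apply (τ : ℝ) (F : 𝓢(ℝ, ℂ)) (x : ℝ) : shift τ F x = F (x - τ) := by
  simp [shift]

theorem fourierInv_apply_eq_neg (F : 𝓢(ℝ, ℂ)) (x : ℝ) : 𝓕⁻ F x = 𝓕 F (-x) := by
  rw [SchwartzMap.fourierInv_coe, SchwartzMap.fourier_coe, Real.fourierInv_eq_fourier_neg]

theorem fourier_mulS (F G : 𝓢(ℝ, ℂ)) (ξ : ℝ) :
    𝓕 (mulS F G) ξ = ∫ η, 𝓕 F (ξ - η) * 𝓕 G η := by
  -- Convolution of Schwartz functions is defined as the inverse transform of the product of the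
  -- transforms, so the formula is immediate for `𝓕⁻`; a reflection carries it over to `𝓕`.
  have h1 : 𝓕⁻ (mulS F G)
      = SchwartzMap.convolution (ContinuousLinearMap.mul ℂ ℂ) (𝓕⁻ F) (𝓕⁻ G) := by
    simp [SchwartzMap.convolution, mulS]
  have h2 := fourierInv_apply_eq_neg (mulS F G) (-ξ)
  rw [neg_neg] at h2
  rw [← h2, h1, SchwartzMap.convolution_apply]
  simp only [convolution, ContinuousLinearMap.mul_apply', fourierInv_apply_eq_neg]
  rw [← integral_sub_right_eq_self _ ξ]
  congr 1; ext x; congr 2 <;> ring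

theorem fourier_shift (τ : ℝ) (F : 𝓢(ℝ, ℂ)) (ξ : ℝ) :
    𝓕 (shift τ F) ξ = Complex.exp (-(2 * Real.pi * τ * ξ : ℝ) * Complex.I) * 𝓕 F ξ := by
  rw [SchwartzMap.fourier_coe, SchwartzMap.fourier_coe, Real.fourier_eq', Real.fourier_eq',
    ← integral_const_mul, ← integral_add_right_eq_self _ τ]
  congr 1; ext x
  simp only [shift_apply, add_sub_cancel_right, smul_eq_mul, ← mul_assoc, ← Complex.exp_add]
  congr 2
  simp
  ring

theorem enorm_fourier_shift (τ : ℝ) (F : 𝓢(ℝ, ℂ)) (ξ : ℝ) :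
    ‖𝓕 (shift τ F) ξ‖ₑ = ‖𝓕 F ξ‖ₑ := by
  rw [fourier_shift, enorm_mul, ← Complex.ofReal_neg, ← ofReal_norm, Complex.norm_exp_ofReal_mul_I]
  simp

theorem enorm_fourier_mulS_le (F G : 𝓢(ℝ, ℂ)) (ξ : ℝ) :
    ‖𝓕 (mulS F G) ξ‖ₑ ≤ ∫⁻ η, ‖𝓕 F (ξ - η)‖ₑ * ‖𝓕 G η‖ₑ := by
  rw [fourier_mulS]
  refine (enorm_integral_le_lintegral_enorm _).trans (le_of_eq ?_)
  simp [enorm_mul]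

theorem lintegral_enorm_sq_eq (F : 𝓢(ℝ, ℂ)) :
    ∫⁻ x, ‖F x‖ₑ ^ 2 = ENNReal.ofReal (∫ x, ‖F x‖ ^ 2) := by
  rw [ofReal_integral_eq_lintegral_ofReal]
  · simp [ENNReal.ofReal_pow]
  · exact (F.memLp 2).integrable_norm_pow (by norm_num)
  · exact ae_of_all _ fun x => by positivity

theorem lintegral_enorm_sq_fourier (F : 𝓢(ℝ, ℂ)) :
    ∫⁻ x, ‖𝓕 F x‖ₑ ^ 2 = ∫⁻ x, ‖F x‖ₑ ^ 2 := by
  rw [lintegral_enorm_sq_eq, lintegral_enorm_sq_eq, SchwartzMap.integral_norm_sq_fourier]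

theorem lintegral_enorm_sq_fourierInv (F : 𝓢(ℝ, ℂ)) :
    ∫⁻ x, ‖𝓕⁻ F x‖ₑ ^ 2 = ∫⁻ x, ‖F x‖ₑ ^ 2 := by
  rw [← lintegral_enorm_sq_fourier (𝓕⁻ F)]; simp

theorem enorm_apply_le_lintegral_fourier (F : 𝓢(ℝ, ℂ)) (x : ℝ) :
    ‖F x‖ₑ ≤ ∫⁻ ξ, ‖𝓕 F ξ‖ₑ := by
  have h : F x = 𝓕⁻ (𝓕 F) x := by simp
  rw [h, SchwartzMap.fourierInv_coe, Real.fourierInv_eq']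
  refine (enorm_integral_le_lintegral_enorm _).trans (lintegral_mono fun ξ => ?_)
  rw [enorm_smul, ← ofReal_norm (Complex.exp _), Complex.norm_exp_ofReal_mul_I]
  simp

/-- For fixed `ξ`, the windowed transform as a function of `τ` is, up to a unimodular factor, the
inverse Fourier transform of `η ↦ 𝓕 χ (ξ - η) * 𝓕 F η`. Plancherel in `τ` does the rest. -/
theorem lintegral_enorm_sq_fourier_shift_mul (χ F : 𝓢(ℝ, ℂ)) (ξ : ℝ) :
    ∫⁻ τ, ‖𝓕 (mulS (shift τ χ) F) ξ‖ₑ ^ 2 = ∫⁻ η, ‖𝓕 χ (ξ - η)‖ₑ ^ 2 * ‖𝓕 F η‖ₑ ^ 2 := by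
  set H : 𝓢(ℝ, ℂ) := mulS (shift ξ (SchwartzMap.compCLMOfContinuousLinearEquiv ℂ
    (ContinuousLinearEquiv.neg ℝ) (𝓕 χ))) (𝓕 F) with hH
  have hHη : ∀ η, H η = 𝓕 χ (ξ - η) * 𝓕 F η := fun η => by simp [hH]
  have key : ∀ τ, 𝓕 (mulS (shift τ χ) F) ξ
      = Complex.exp (-(2 * Real.pi * τ * ξ : ℝ) * Complex.I) * 𝓕⁻ H τ := by
    intro τ
    rw [fourier_mulS, SchwartzMap.fourierInv_coe, Real.fourierInv_eq', ← integral_const_mul]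
    congr 1; ext η
    rw [hHη, fourier_shift, smul_eq_mul, ← mul_assoc, ← mul_assoc, ← Complex.exp_add]
    congr 3
    simp
    ring
  simp_rw [key, enorm_mul, ← Complex.ofReal_neg]
  have : ∀ τ : ℝ, ‖Complex.exp ((-(2 * Real.pi * τ * ξ) : ℝ) * Complex.I)‖ₑ = 1 := fun τ => by
    rw [← ofReal_norm, Complex.norm_exp_ofReal_mul_I]; simp
  simp_rw [this, one_mul, lintegral_enorm_sq_fourierInv, hHη, enorm_mul, mul_pow]

/-- Supplies the joint measurability in `(τ, ξ)` that Tonelli requires below. -/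
theorem continuous_fourier_shift_mul (χ F : 𝓢(ℝ, ℂ)) :
    Continuous fun p : ℝ × ℝ => 𝓕 (mulS (shift p.1 χ) F) p.2 := by
  have : ∀ p : ℝ × ℝ, 𝓕 (mulS (shift p.1 χ) F) p.2 =
      ∫ x, Complex.exp ((-2 * Real.pi * (p.2 * x) : ℝ) * Complex.I) * (χ (x - p.1) * F x) := by
    intro p
    rw [SchwartzMap.fourier_coe, Real.fourier_eq']
    simp
  simp_rw [this]
  obtain ⟨C, hC⟩ : ∃ C, ∀ x, ‖χ x‖ ≤ C := ⟨_, χ.norm_le_seminorm ℝ⟩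
  refine continuous_of_dominated (bound := fun x => C * ‖F x‖) ?_ ?_ ?_ ?_
  · intro p; exact Continuous.aestronglyMeasurable (by fun_prop)
  · intro p; refine ae_of_all _ fun x => ?_
    rw [norm_mul, Complex.norm_exp_ofReal_mul_I, one_mul, norm_mul]
    gcongr; exact hC _
  · exact F.integrable.norm.const_mul C
  · exact ae_of_all _ fun x => by fun_prop

end

section

/-! ### Weighted Fourier norms -/

/-- A moderately growing weight on frequency space: quasi-subadditive and submultiplicative against
the polynomial `(1 + |η|) ^ M`, and bounded below by `|ξ| ^ N`. -/
structure IsWeight (A : ℝ≥0) (M N : ℕ) (w : ℝ → ℝ≥0∞) : Prop where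
  meas : Measurable w
  add_le : ∀ ξ η, w (ξ + η) ≤ A * (w ξ + w η)
  moderate : ∀ ξ η, w (ξ + η) ≤ A * (1 + ‖η‖ₑ) ^ M * w ξ
  pow_le : ∀ ξ, ‖ξ‖ₑ ^ N ≤ w ξ
  zero_le : w 0 ≤ A

/-- The squared weighted norm `∫ (w |𝓕 F|)²`. -/
noncomputable def wq (w : ℝ → ℝ≥0∞) (F : 𝓢(ℝ, ℂ)) : ℝ≥0∞ := ∫⁻ ξ, (w ξ * ‖𝓕 F ξ‖ₑ) ^ 2

/-- The `L¹` norm of the Fourier transform against the polynomial weight `(1 + |ξ|) ^ M`. -/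
noncomputable def fourierL1 (M : ℕ) (F : 𝓢(ℝ, ℂ)) : ℝ≥0∞ := ∫⁻ ξ, (1 + ‖ξ‖ₑ) ^ M * ‖𝓕 F ξ‖ₑ

theorem fourierL1_shift (M : ℕ) (τ : ℝ) (F : 𝓢(ℝ, ℂ)) : fourierL1 M (shift τ F) = fourierL1 M F := by
  simp [fourierL1, enorm_fourier_shift]

theorem lintegral_pow_mul_enorm_lt_top (M : ℕ) (F : 𝓢(ℝ, ℂ)) :
    ∫⁻ ξ, (1 + ‖ξ‖ₑ) ^ M * ‖F ξ‖ₑ < ⊤ := by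
  have h : Integrable (fun ξ : ℝ => (2 : ℝ) ^ M * (‖F ξ‖ + ‖ξ‖ ^ M * ‖F ξ‖)) :=
    (F.integrable.norm.add (F.integrable_pow_mul volume M)).const_mul _
  refine lt_of_le_of_lt (lintegral_mono fun ξ => ?_) h.lintegral_lt_top
  have e1 : (1 + ‖ξ‖ₑ) ^ M * ‖F ξ‖ₑ = ENNReal.ofReal ((1 + ‖ξ‖) ^ M * ‖F ξ‖) := by
    rw [ENNReal.ofReal_mul (by positivity), ENNReal.ofReal_pow (by positivity),
      ENNReal.ofReal_add (by positivity) (by positivity)]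
    simp only [ofReal_norm, ENNReal.ofReal_one]
  rw [e1]
  refine ENNReal.ofReal_le_ofReal ?_
  have : (1 + ‖ξ‖) ^ M ≤ 2 ^ M * (1 + ‖ξ‖ ^ M) := by
    refine (add_pow_le (by norm_num) (norm_nonneg ξ) M).trans ?_
    rw [one_pow]
    gcongr
    · norm_num
    · omega
  calc _ ≤ 2 ^ M * (1 + ‖ξ‖ ^ M) * ‖F ξ‖ := by gcongr
    _ = _ := by ring

theorem fourierL1_lt_top (M : ℕ) (F : 𝓢(ℝ, ℂ)) : fourierL1 M F < ⊤ :=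
  lintegral_pow_mul_enorm_lt_top M (𝓕 F)

theorem lintegral_pow_mul_enorm_sq_lt_top (M : ℕ) (F : 𝓢(ℝ, ℂ)) :
    ∫⁻ ξ, ((1 + ‖ξ‖ₑ) ^ M * ‖F ξ‖ₑ) ^ 2 < ⊤ := by
  obtain ⟨C, hC⟩ : ∃ C, ∀ x, ‖F x‖ ≤ C := ⟨_, F.norm_le_seminorm ℝ⟩
  refine lt_of_le_of_lt (b := ENNReal.ofReal C * ∫⁻ ξ, (1 + ‖ξ‖ₑ) ^ (2 * M) * ‖F ξ‖ₑ) ?_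
    (ENNReal.mul_lt_top ENNReal.ofReal_lt_top (lintegral_pow_mul_enorm_lt_top _ F))
  rw [← lintegral_const_mul _ (by fun_prop)]
  refine lintegral_mono fun ξ => ?_
  calc ((1 + ‖ξ‖ₑ) ^ M * ‖F ξ‖ₑ) ^ 2 = ‖F ξ‖ₑ * ((1 + ‖ξ‖ₑ) ^ (2 * M) * ‖F ξ‖ₑ) := by ring
    _ ≤ _ := by
      gcongr
      rw [← ofReal_norm]
      exact ENNReal.ofReal_le_ofReal (hC ξ)

variable {A : ℝ≥0} {M N : ℕ} {w : ℝ → ℝ≥0∞}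

theorem IsWeight.le_pow (hw : IsWeight A M N w) (ξ : ℝ) : w ξ ≤ A ^ 2 * (1 + ‖ξ‖ₑ) ^ M := by
  have := hw.moderate 0 ξ
  rw [zero_add] at this
  refine this.trans ?_
  calc _ ≤ (A : ℝ≥0∞) * (1 + ‖ξ‖ₑ) ^ M * A := by gcongr; exact hw.zero_le
    _ = _ := by ring

theorem IsWeight.wq_le (hw : IsWeight A M N w) (F : 𝓢(ℝ, ℂ)) :
    wq w F ≤ A ^ 4 * ∫⁻ ξ, ((1 + ‖ξ‖ₑ) ^ M * ‖𝓕 F ξ‖ₑ) ^ 2 := by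
  rw [← lintegral_const_mul _ (by fun_prop)]
  refine lintegral_mono fun ξ => ?_
  calc _ ≤ (A ^ 2 * (1 + ‖ξ‖ₑ) ^ M * ‖𝓕 F ξ‖ₑ) ^ 2 := by gcongr; exact hw.le_pow ξ
    _ = _ := by ring

/-- Moderateness charges the growth of the weight to `G` alone; then Young, `L¹ * L² → L²`. Used
when `G` is a window or a multiplier cut off by a window. -/
theorem IsWeight.wq_mulS_le_fourierL1 (hw : IsWeight A M N w) (G H : 𝓢(ℝ, ℂ)) :
    wq w (mulS G H) ≤ A ^ 2 * fourierL1 M G ^ 2 * wq w H := by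
  have hm := hw.meas
  calc wq w (mulS G H)
      ≤ ∫⁻ ξ, A ^ 2 * (∫⁻ η, ((1 + ‖ξ - η‖ₑ) ^ M * ‖𝓕 G (ξ - η)‖ₑ) * (w η * ‖𝓕 H η‖ₑ)) ^ 2 := by
        refine lintegral_mono fun ξ => ?_
        rw [← mul_pow]
        refine pow_le_pow_left' ?_ 2
        calc _ ≤ w ξ * ∫⁻ η, ‖𝓕 G (ξ - η)‖ₑ * ‖𝓕 H η‖ₑ := by
              gcongr; exact enorm_fourier_mulS_le G H ξ
          _ = ∫⁻ η, w ξ * (‖𝓕 G (ξ - η)‖ₑ * ‖𝓕 H η‖ₑ) := by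
              rw [lintegral_const_mul _ (by fun_prop)]
          _ ≤ ∫⁻ η, A * (((1 + ‖ξ - η‖ₑ) ^ M * ‖𝓕 G (ξ - η)‖ₑ) * (w η * ‖𝓕 H η‖ₑ)) := by
              refine lintegral_mono fun η => ?_
              have := hw.moderate η (ξ - η)
              rw [add_sub_cancel] at this
              calc _ ≤ (A * (1 + ‖ξ - η‖ₑ) ^ M * w η) * (‖𝓕 G (ξ - η)‖ₑ * ‖𝓕 H η‖ₑ) := by gcongr
                _ = _ := by ring
          _ = _ := by rw [lintegral_const_mul _ (by fun_prop)]
    _ = A ^ 2 * ∫⁻ ξ, (∫⁻ η, ((1 + ‖ξ - η‖ₑ) ^ M * ‖𝓕 G (ξ - η)‖ₑ) * (w η * ‖𝓕 H η‖ₑ)) ^ 2 := by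
        rw [lintegral_const_mul' _ _ (by simp)]
    _ ≤ A ^ 2 * (fourierL1 M G ^ 2 * wq w H) := by
        gcongr
        exact young_sq' (a := fun ξ => (1 + ‖ξ‖ₑ) ^ M * ‖𝓕 G ξ‖ₑ) (b := fun η => w η * ‖𝓕 H η‖ₑ)
          (by fun_prop) (by fun_prop)
    _ = _ := by ring

/-- Quasi-subadditivity puts the weight on one factor at a time, so the other factor enters only
through its unweighted Wiener norm. -/
theorem IsWeight.wq_mulS_le (hw : IsWeight A M N w) (G H : 𝓢(ℝ, ℂ)) :
    wq w (mulS G H) ≤ 2 * A ^ 2 * (wq w G * fourierL1 0 H ^ 2 + fourierL1 0 G ^ 2 * wq w H) := by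
  have hm := hw.meas
  set a : ℝ → ℝ≥0∞ := fun ξ => w ξ * ‖𝓕 G ξ‖ₑ with ha
  set b : ℝ → ℝ≥0∞ := fun ξ => w ξ * ‖𝓕 H ξ‖ₑ with hb
  set g : ℝ → ℝ≥0∞ := fun ξ => ‖𝓕 G ξ‖ₑ with hg
  set h : ℝ → ℝ≥0∞ := fun ξ => ‖𝓕 H ξ‖ₑ with hh
  have hgm : Measurable g := by fun_prop
  have hhm : Measurable h := by fun_prop
  have ham : Measurable a := by fun_prop
  have hbm : Measurable b := by fun_prop
  calc wq w (mulS G H)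
      ≤ ∫⁻ ξ, 2 * A ^ 2 * ((∫⁻ η, a (ξ - η) * h η) ^ 2 +
          (∫⁻ η, g (ξ - η) * b η) ^ 2) := by
        refine lintegral_mono fun ξ => ?_
        calc _ ≤ (A * ((∫⁻ η, a (ξ - η) * h η) + (∫⁻ η, g (ξ - η) * b η))) ^ 2 := by
              refine pow_le_pow_left' ?_ 2
              calc _ ≤ w ξ * ∫⁻ η, g (ξ - η) * h η := by
                    gcongr; exact enorm_fourier_mulS_le G H ξ
                _ = ∫⁻ η, w ξ * (g (ξ - η) * h η) := by
                    rw [lintegral_const_mul _ (by fun_prop)]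
                _ ≤ ∫⁻ η, A * (a (ξ - η) * h η + g (ξ - η) * b η) := by
                    refine lintegral_mono fun η => ?_
                    have := hw.add_le (ξ - η) η
                    rw [sub_add_cancel] at this
                    calc _ ≤ (A * (w (ξ - η) + w η)) * (g (ξ - η) * h η) := by gcongr
                      _ = _ := by simp only [ha, hb, hg, hh]; ring
                _ = _ := by
                    rw [lintegral_const_mul _ (by fun_prop), lintegral_add_left (by fun_prop)]
          _ = A ^ 2 * ((∫⁻ η, a (ξ - η) * h η) + (∫⁻ η, g (ξ - η) * b η)) ^ 2 := by
              rw [mul_pow]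
          _ ≤ A ^ 2 * (2 * ((∫⁻ η, a (ξ - η) * h η) ^ 2 +
                (∫⁻ η, g (ξ - η) * b η) ^ 2)) := by gcongr; exact add_sq_le_two_mul _ _
          _ = _ := by ring
    _ = 2 * A ^ 2 * ((∫⁻ ξ, (∫⁻ η, a (ξ - η) * h η) ^ 2) +
          ∫⁻ ξ, (∫⁻ η, g (ξ - η) * b η) ^ 2) := by
        rw [lintegral_const_mul' _ _ (by finiteness), lintegral_add_left]
        refine Measurable.pow_const (Measurable.lintegral_prod_right'
          (f := fun p : ℝ × ℝ => a (p.1 - p.2) * h p.2) (by fun_prop)) 2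
    _ ≤ _ := by
        have e1 := young_sq (a := a) (b := h) ham hhm
        have e2 := young_sq' (a := g) (b := b) hgm hbm
        simp only [fourierL1, pow_zero, one_mul, wq]
        gcongr

/-! ### Localisation in physical space -/

/-- Averaging over windows replaces `w²` by its mean against `|𝓕 χ|²`. Moderateness compares this
mean with `w²` from both sides, which gives the next two estimates. -/
theorem IsWeight.lintegral_wq_shift_mul (hw : IsWeight A M N w) (χ F : 𝓢(ℝ, ℂ)) :
    ∫⁻ τ, wq w (mulS (shift τ χ) F)
      = ∫⁻ η, (∫⁻ ξ, w (ξ + η) ^ 2 * ‖𝓕 χ ξ‖ₑ ^ 2) * ‖𝓕 F η‖ₑ ^ 2 := by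
  have hm := hw.meas
  calc ∫⁻ τ, wq w (mulS (shift τ χ) F)
      = ∫⁻ ξ, ∫⁻ τ, (w ξ * ‖𝓕 (mulS (shift τ χ) F) ξ‖ₑ) ^ 2 := by
        simp only [wq]
        rw [lintegral_lintegral_swap]
        have := (continuous_fourier_shift_mul χ F).measurable
        exact Measurable.aemeasurable (((hm.comp measurable_snd).mul this.enorm).pow_const 2)
    _ = ∫⁻ ξ, ∫⁻ η, w ξ ^ 2 * (‖𝓕 χ (ξ - η)‖ₑ ^ 2 * ‖𝓕 F η‖ₑ ^ 2) := by
        refine lintegral_congr fun ξ => ?_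
        simp_rw [mul_pow]
        rw [lintegral_const_mul, lintegral_enorm_sq_fourier_shift_mul,
          lintegral_const_mul _ (by fun_prop)]
        have := ((continuous_fourier_shift_mul χ F).comp
          (continuous_id.prodMk (continuous_const (y := ξ)))).measurable
        exact this.enorm.pow_const 2
    _ = ∫⁻ η, ∫⁻ ξ, w ξ ^ 2 * (‖𝓕 χ (ξ - η)‖ₑ ^ 2 * ‖𝓕 F η‖ₑ ^ 2) := by
        rw [lintegral_lintegral_swap]
        exact Measurable.aemeasurable (by fun_prop)
    _ = _ := by
        refine lintegral_congr fun η => ?_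
        rw [← lintegral_mul_const _ (by fun_prop), ← lintegral_add_right_eq_self _ η]
        simp [mul_assoc]

theorem IsWeight.lintegral_wq_shift_mul_le (hw : IsWeight A M N w) (χ F : 𝓢(ℝ, ℂ)) :
    ∫⁻ τ, wq w (mulS (shift τ χ) F)
      ≤ (A ^ 2 * ∫⁻ ξ, ((1 + ‖ξ‖ₑ) ^ M * ‖𝓕 χ ξ‖ₑ) ^ 2) * wq w F := by
  have hm := hw.meas
  rw [hw.lintegral_wq_shift_mul, wq, ← lintegral_const_mul _ (by fun_prop)]
  refine lintegral_mono fun η => ?_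
  rw [mul_pow, ← mul_assoc]
  gcongr
  rw [← lintegral_const_mul _ (by fun_prop), ← lintegral_mul_const _ (by fun_prop)]
  refine lintegral_mono fun ξ => ?_
  calc _ ≤ (A * (1 + ‖ξ‖ₑ) ^ M * w η) ^ 2 * ‖𝓕 χ ξ‖ₑ ^ 2 := by
        gcongr
        rw [add_comm]
        exact hw.moderate η ξ
    _ = _ := by ring

theorem IsWeight.wq_le_lintegral_wq_shift_mul (hw : IsWeight A M N w) (χ F : 𝓢(ℝ, ℂ)) :
    (∫⁻ ξ, ((1 + ‖ξ‖ₑ) ^ M)⁻¹ ^ 2 * ‖𝓕 χ ξ‖ₑ ^ 2) * wq w F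
      ≤ A ^ 2 * ∫⁻ τ, wq w (mulS (shift τ χ) F) := by
  have hm := hw.meas
  rw [hw.lintegral_wq_shift_mul, wq, ← lintegral_const_mul _ (by fun_prop),
    ← lintegral_const_mul' _ _ (by finiteness)]
  refine lintegral_mono fun η => ?_
  simp only []
  rw [mul_pow, ← mul_assoc, ← mul_assoc]
  refine mul_le_mul_left ?_ _
  rw [← lintegral_const_mul' _ _ (by finiteness), ← lintegral_mul_const _ (by fun_prop)]
  refine lintegral_mono fun ξ => ?_
  have h := hw.moderate (ξ + η) (-ξ)
  rw [show ξ + η + -ξ = η by ring, enorm_neg] at h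
  have hJ : ((1 + ‖ξ‖ₑ) ^ M)⁻¹ * (1 + ‖ξ‖ₑ) ^ M = 1 :=
    ENNReal.inv_mul_cancel (by simp) (by finiteness)
  calc _ ≤ ((1 + ‖ξ‖ₑ) ^ M)⁻¹ ^ 2 * ‖𝓕 χ ξ‖ₑ ^ 2 * (A * (1 + ‖ξ‖ₑ) ^ M * w (ξ + η)) ^ 2 := by
        gcongr
    _ = (((1 + ‖ξ‖ₑ) ^ M)⁻¹ * (1 + ‖ξ‖ₑ) ^ M) ^ 2 * (A ^ 2 * (w (ξ + η) ^ 2 * ‖𝓕 χ ξ‖ₑ ^ 2)) := by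
        ring
    _ = _ := by rw [hJ]; simp

/-- The constant comes from `∫ (1 + |ξ|)^(-2M) |𝓕 χ|²`, which is positive since `χ ≠ 0`, finite
since `𝓕 χ` is square integrable, and independent of the weight. -/
theorem exists_wq_le_lintegral (A : ℝ≥0) (M : ℕ) {χ : 𝓢(ℝ, ℂ)} (hχ : χ ≠ 0) :
    ∃ C : ℝ≥0, ∀ (N : ℕ) (w : ℝ → ℝ≥0∞), IsWeight A M N w → ∀ F : 𝓢(ℝ, ℂ),
      wq w F ≤ C * ∫⁻ τ, wq w (mulS (shift τ χ) F) := by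
  set c := ∫⁻ ξ, ((1 + ‖ξ‖ₑ) ^ M)⁻¹ ^ 2 * ‖𝓕 χ ξ‖ₑ ^ 2 with hc
  have hc0 : c ≠ 0 := by
    intro h
    rw [hc, lintegral_eq_zero_iff (by fun_prop)] at h
    have h2 : (fun ξ => 𝓕 χ ξ) =ᵐ[volume] fun _ => (0 : ℂ) := by
      filter_upwards [h] with ξ hξ
      simp only [Pi.zero_apply, mul_eq_zero, pow_eq_zero_iff, ne_eq, OfNat.ofNat_ne_zero,
        not_false_eq_true, ENNReal.inv_eq_zero, enorm_eq_zero] at hξ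
      refine hξ.resolve_left (by finiteness)
    have h3 := Continuous.ae_eq_iff_eq volume (𝓕 χ).continuous continuous_const |>.1 h2
    apply hχ
    have h4 : 𝓕 χ = 0 := SchwartzMap.ext fun x => congrFun h3 x
    have h5 : 𝓕⁻ (𝓕 χ) = 0 := by rw [h4]; simp
    simpa using h5
  have hci : c⁻¹ ≠ ⊤ := by simp [hc0]
  have hct : c ≠ ⊤ := by
    refine ((lintegral_mono fun ξ => ?_).trans_lt
      (lintegral_pow_mul_enorm_sq_lt_top 0 (𝓕 χ))).ne
    rw [pow_zero, one_mul]
    refine mul_le_of_le_one_left' ?_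
    refine pow_le_one' (ENNReal.inv_le_one.2 (one_le_pow₀ (by simp))) 2
  refine ⟨(c⁻¹ * A ^ 2).toNNReal, fun N w hw F => ?_⟩
  rw [ENNReal.coe_toNNReal (by finiteness), mul_assoc]
  have := hw.wq_le_lintegral_wq_shift_mul χ F
  rw [← hc] at this
  calc wq w F = c⁻¹ * (c * wq w F) := by
        rw [← mul_assoc, ENNReal.inv_mul_cancel hc0 hct, one_mul]
    _ ≤ _ := by gcongr

end

section

/-! ### The Wiener norm of localised pieces -/

theorem lintegral_ofReal_two_mul_inv_le {R : ℝ} (hR : 0 < R) :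
    ∫⁻ ξ : ℝ, ENNReal.ofReal (2 * R⁻¹ * (1 + (ξ / R) ^ 2)⁻¹) = ENNReal.ofReal (2 * Real.pi) := by
  have hi : Integrable fun ξ : ℝ => 2 * R⁻¹ * (1 + (ξ / R) ^ 2)⁻¹ :=
    (integrable_inv_one_add_sq.comp_div hR.ne').const_mul _
  rw [← ofReal_integral_eq_lintegral_ofReal hi (ae_of_all _ fun ξ => by positivity),
    integral_const_mul, Measure.integral_comp_div (fun x : ℝ => (1 + x ^ 2)⁻¹) R,
    integral_univ_inv_one_add_sq, abs_of_pos hR, smul_eq_mul]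
  congr 1
  field_simp

/-- An inequality of Agmon type for the Wiener norm, with a free scale `R`. -/
theorem fourierL1_sq_le (G : 𝓢(ℝ, ℂ)) {R : ℝ} (hR : 0 < R) {N : ℕ} (hN : 1 ≤ N) :
    fourierL1 0 G ^ 2 ≤ ENNReal.ofReal (2 * Real.pi) *
      (ENNReal.ofReal R * (∫⁻ ξ, ‖𝓕 G ξ‖ₑ ^ 2)
        + ENNReal.ofReal (R⁻¹ ^ (2 * N - 1)) * ∫⁻ ξ, (‖ξ‖ₑ ^ N * ‖𝓕 G ξ‖ₑ) ^ 2) := by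
  -- Cauchy–Schwarz against `ρ = R (1 + (|ξ|/R)^(2N))`. Since `1 + y² ≤ 2 (1 + y^(2N))`, the
  -- integral of `1/ρ` is at most `2π` for every `R`.
  set ρ : ℝ → ℝ := fun ξ => R + R⁻¹ ^ (2 * N - 1) * |ξ| ^ (2 * N) with hρ
  have hρc : Continuous ρ := by fun_prop
  have hρ0 : ∀ ξ, 0 < ρ ξ := fun ξ => by positivity
  have hρm : Measurable fun ξ => ENNReal.ofReal (√(ρ ξ)) := by fun_prop
  have hsq : ∀ ξ, ENNReal.ofReal (√(ρ ξ)) ^ 2 = ENNReal.ofReal (ρ ξ) := fun ξ => by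
    rw [← ENNReal.ofReal_pow (by positivity), Real.sq_sqrt (hρ0 ξ).le]
  have hne : ∀ ξ, ENNReal.ofReal (√(ρ ξ)) ≠ 0 := fun ξ => by
    simpa using hρ0 ξ
  have h1 : fourierL1 0 G
      = ∫⁻ ξ, (ENNReal.ofReal (√(ρ ξ)))⁻¹ * (ENNReal.ofReal (√(ρ ξ)) * ‖𝓕 G ξ‖ₑ) := by
    refine lintegral_congr fun ξ => ?_
    rw [← mul_assoc, ENNReal.inv_mul_cancel (hne ξ) ENNReal.ofReal_ne_top, pow_zero]
  rw [h1]
  refine (sq_lintegral_mul_le (by fun_prop) (by fun_prop)).trans ?_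
  gcongr
  · rw [← lintegral_ofReal_two_mul_inv_le hR]
    refine lintegral_mono fun ξ => ?_
    rw [← ENNReal.inv_pow, hsq, ← ENNReal.ofReal_inv_of_pos (hρ0 ξ)]
    refine ENNReal.ofReal_le_ofReal ?_
    have e : ρ ξ = R * (1 + (|ξ| / R) ^ (2 * N)) := by
      obtain ⟨n, rfl⟩ : ∃ n, N = n + 1 := ⟨N - 1, by omega⟩
      have hR' : R ^ (2 * (n + 1)) = R * R ^ (2 * n + 1) := by ring
      simp only [hρ, show 2 * (n + 1) - 1 = 2 * n + 1 by omega, inv_pow, div_pow, hR']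
      field_simp
    have h2 : (1 + (ξ / R) ^ 2) ≤ 2 * (1 + (|ξ| / R) ^ (2 * N)) := by
      have hy : (ξ / R) ^ 2 = (|ξ| / R) ^ 2 := by rw [div_pow, div_pow, sq_abs]
      rw [hy]
      set y := |ξ| / R
      have hy0 : 0 ≤ y := by positivity
      rcases le_total y 1 with h | h
      · have := pow_le_one₀ hy0 h (n := 2)
        have : 0 ≤ y ^ (2 * N) := by positivity
        linarith
      · have := pow_le_pow_right₀ h (show 2 ≤ 2 * N by omega)
        have : 0 ≤ y ^ (2 * N) := by positivity
        linarith
    have h3 : (1 + (|ξ| / R) ^ (2 * N))⁻¹ ≤ 2 * (1 + (ξ / R) ^ 2)⁻¹ := by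
      rw [← div_eq_mul_inv, inv_eq_one_div, div_le_div_iff₀ (by positivity) (by positivity)]
      linarith
    calc (ρ ξ)⁻¹ = R⁻¹ * (1 + (|ξ| / R) ^ (2 * N))⁻¹ := by rw [e, mul_inv]
      _ ≤ R⁻¹ * (2 * (1 + (ξ / R) ^ 2)⁻¹) := by gcongr
      _ = _ := by ring
  · rw [← lintegral_const_mul _ (by fun_prop), ← lintegral_const_mul _ (by fun_prop),
      ← lintegral_add_left (by fun_prop)]
    refine lintegral_mono fun ξ => ?_
    rw [mul_pow, hsq, ENNReal.ofReal_add hR.le (by positivity), ENNReal.ofReal_mul (by positivity),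
      ENNReal.ofReal_pow (abs_nonneg ξ), ← Real.norm_eq_abs, ofReal_norm]
    exact le_of_eq (by ring)

/-- A fixed smooth bump function on the line, equal to `1` near the origin. -/
noncomputable def bump : ContDiffBump (0 : ℝ) := ⟨1, 2, by norm_num, by norm_num⟩

/-- The compactly supported window `e^(-σu) bump(u)`. -/
noncomputable def window (σ : ℝ) : 𝓢(ℝ, ℂ) :=
  HasCompactSupport.toSchwartzMap (f := fun u => ((Real.exp (-σ * u) * bump u : ℝ) : ℂ))
    (HasCompactSupport.comp_left (g := Complex.ofReal) bump.hasCompactSupport.mul_left rfl)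
    (Complex.ofRealCLM.contDiff.comp (ContDiff.mul (by fun_prop) bump.contDiff))

theorem window_apply (σ u : ℝ) : window σ u = ((Real.exp (-σ * u) * bump u : ℝ) : ℂ) := rfl

theorem bump_zero : bump (0 : ℝ) = 1 := bump.one_of_mem_closedBall (by simp [bump])

theorem exp_mul_bump_sq_le (v : ℝ) : Real.exp v * bump v ^ 2 ≤ Real.exp 2 := by
  rcases le_total v 2 with h | h
  · calc Real.exp v * bump v ^ 2 ≤ Real.exp v * 1 := by
          gcongr
          exact pow_le_one₀ bump.nonneg bump.le_one
      _ ≤ _ := by simpa using h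
  · have : bump v = 0 := bump.zero_of_le_dist (by
      rw [Real.dist_eq, sub_zero]; exact h.trans (le_abs_self v))
    rw [this]; simp [Real.exp_nonneg]

/-- The squared norm of `x ↦ h x` in `L²(0, ∞)` in terms of `F u = e^(σu) h (e^(-u))`. -/
noncomputable def lq (σ : ℝ) (F : 𝓢(ℝ, ℂ)) : ℝ≥0∞ :=
  ∫⁻ u, ENNReal.ofReal (Real.exp (-(1 + 2 * σ) * u)) * ‖F u‖ₑ ^ 2

theorem enorm_ofReal_sq (a : ℝ) : ‖(a : ℂ)‖ₑ ^ 2 = ENNReal.ofReal (a ^ 2) := by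
  rw [← ofReal_norm, ← ENNReal.ofReal_pow (norm_nonneg _), Complex.norm_real, Real.norm_eq_abs,
    sq_abs]

/-- The exponential in the window turns `e^(-(1+2σ)τ)` into the density `e^(-(1+2σ)u)` of `lq`, up
to `e^(u-τ)`, which is at most `e²` on the support of the bump. -/
theorem lintegral_window_mul_le (σ τ : ℝ) (F : 𝓢(ℝ, ℂ)) :
    ENNReal.ofReal (Real.exp (-2 * σ * τ)) * (ENNReal.ofReal (Real.exp (-τ)) *
      ∫⁻ u, ‖mulS (shift τ (window σ)) F u‖ₑ ^ 2) ≤ ENNReal.ofReal (Real.exp 2) * lq σ F := by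
  rw [lq, ← lintegral_const_mul _ (by fun_prop), ← lintegral_const_mul _ (by fun_prop),
    ← lintegral_const_mul _ (by fun_prop)]
  refine lintegral_mono fun u => ?_
  rw [mulS_apply, shift_apply, window_apply, enorm_mul, mul_pow, enorm_ofReal_sq, ← mul_assoc,
    ← mul_assoc, ← mul_assoc]
  refine mul_le_mul_left ?_ _
  rw [← ENNReal.ofReal_mul (by positivity), ← ENNReal.ofReal_mul (by positivity),
    ← ENNReal.ofReal_mul (by positivity)]
  refine ENNReal.ofReal_le_ofReal ?_
  calc _ = Real.exp (-(1 + 2 * σ) * u) * (Real.exp (u - τ) * bump (u - τ) ^ 2) := by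
        have h : Real.exp (-2 * σ * τ) * Real.exp (-τ) * Real.exp (2 * (-σ * (u - τ)))
            = Real.exp (-(1 + 2 * σ) * u) * Real.exp (u - τ) := by
          rw [← Real.exp_add, ← Real.exp_add, ← Real.exp_add]
          congr 1
          ring
        rw [mul_pow, ← Real.exp_nat_mul, Nat.cast_ofNat]
        linear_combination (bump (u - τ)) ^ 2 * h
    _ ≤ Real.exp (-(1 + 2 * σ) * u) * Real.exp 2 := by
        gcongr; exact exp_mul_bump_sq_le _
    _ = _ := mul_comm _ _

/-- The Agmon inequality at scale `R = e^(-τ)`. Because `2σ = 2N - 1`, the factor `e^(-2στ)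
R^(-(2N-1))` of the top-order term is exactly `1`, while `e^(-2στ) R` is the density of `lq` at `τ`.
Hence a bound independent of `τ`. -/
theorem exists_fourierL1_window_le (A : ℝ≥0) (M : ℕ) {N : ℕ} (hN : 1 ≤ N) {σ : ℝ}
    (hσ : 2 * σ = 2 * N - 1) :
    ∃ C : ℝ≥0, ∀ w, IsWeight A M N w → ∀ (F : 𝓢(ℝ, ℂ)) (τ : ℝ),
      ENNReal.ofReal (Real.exp (-2 * σ * τ)) * fourierL1 0 (mulS (shift τ (window σ)) F) ^ 2
        ≤ C * (lq σ F + wq w F) := by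
  set K := fourierL1 M (window σ) with hK
  have hKt : K ≠ ⊤ := (fourierL1_lt_top _ _).ne
  set c : ℝ≥0∞ := ENNReal.ofReal (2 * Real.pi) * (ENNReal.ofReal (Real.exp 2) + A ^ 2 * K ^ 2)
    with hc
  have hct : c ≠ ⊤ := by finiteness
  refine ⟨c.toNNReal, fun w hw F τ => ?_⟩
  rw [ENNReal.coe_toNNReal hct]
  set G := mulS (shift τ (window σ)) F with hG
  have h1 := fourierL1_sq_le G (Real.exp_pos (-τ)) hN
  have h2 : ∫⁻ ξ, (‖ξ‖ₑ ^ N * ‖𝓕 G ξ‖ₑ) ^ 2 ≤ A ^ 2 * K ^ 2 * wq w F := by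
    refine le_trans ?_ ((hw.wq_mulS_le_fourierL1 (shift τ (window σ)) F).trans (le_of_eq ?_))
    · refine lintegral_mono fun ξ => ?_
      gcongr
      exact hw.pow_le ξ
    · rw [fourierL1_shift]
  have h3 : ENNReal.ofReal (Real.exp (-2 * σ * τ)) *
      ENNReal.ofReal ((Real.exp (-τ))⁻¹ ^ (2 * N - 1)) = 1 := by
    rw [← ENNReal.ofReal_mul (by positivity), ← Real.exp_neg, neg_neg, ← Real.exp_nat_mul,
      ← Real.exp_add, Nat.cast_sub (by omega)]
    push_cast
    rw [← hσ]
    simp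
  have h4 := lintegral_window_mul_le σ τ F
  rw [← hG, ← lintegral_enorm_sq_fourier] at h4
  calc _ ≤ ENNReal.ofReal (Real.exp (-2 * σ * τ)) * (ENNReal.ofReal (2 * Real.pi) *
      (ENNReal.ofReal (Real.exp (-τ)) * (∫⁻ ξ, ‖𝓕 G ξ‖ₑ ^ 2)
        + ENNReal.ofReal ((Real.exp (-τ))⁻¹ ^ (2 * N - 1)) *
          ∫⁻ ξ, (‖ξ‖ₑ ^ N * ‖𝓕 G ξ‖ₑ) ^ 2)) := by gcongr
    _ = ENNReal.ofReal (2 * Real.pi) * (ENNReal.ofReal (Real.exp (-2 * σ * τ)) *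
          (ENNReal.ofReal (Real.exp (-τ)) * (∫⁻ ξ, ‖𝓕 G ξ‖ₑ ^ 2))
        + (ENNReal.ofReal (Real.exp (-2 * σ * τ)) *
          ENNReal.ofReal ((Real.exp (-τ))⁻¹ ^ (2 * N - 1))) *
            ∫⁻ ξ, (‖ξ‖ₑ ^ N * ‖𝓕 G ξ‖ₑ) ^ 2) := by ring
    _ ≤ ENNReal.ofReal (2 * Real.pi) * (ENNReal.ofReal (Real.exp 2) * lq σ F
          + A ^ 2 * K ^ 2 * wq w F) := by
        rw [h3, one_mul]
        gcongr
    _ ≤ ENNReal.ofReal (2 * Real.pi) * (ENNReal.ofReal (Real.exp 2) * (lq σ F + wq w F)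
          + A ^ 2 * K ^ 2 * (lq σ F + wq w F)) := by
        gcongr
        · exact le_self_add
        · exact le_add_self
    _ = _ := by rw [hc]; ring

theorem enorm_sq_le_fourierL1_window (σ τ : ℝ) (F : 𝓢(ℝ, ℂ)) :
    ‖F τ‖ₑ ^ 2 ≤ fourierL1 0 (mulS (shift τ (window σ)) F) ^ 2 := by
  have h := enorm_apply_le_lintegral_fourier (mulS (shift τ (window σ)) F) τ
  rw [mulS_apply, shift_apply, window_apply, sub_self, bump_zero] at h
  simp only [mul_zero, Real.exp_zero, mul_one, Complex.ofReal_one, one_mul] at h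
  simpa [fourierL1] using pow_le_pow_left' h 2

/-! ### The product estimate in logarithmic coordinates -/

theorem wq_smul (w : ℝ → ℝ≥0∞) (c : ℂ) (F : 𝓢(ℝ, ℂ)) : wq w (c • F) = ‖c‖ₑ ^ 2 * wq w F := by
  rw [wq, wq, ← lintegral_const_mul' _ _ (by finiteness)]
  refine lintegral_congr fun ξ => ?_
  have : 𝓕 (c • F) ξ = c * 𝓕 F ξ := by rw [FourierTransform.fourier_smul]; rfl
  rw [this, enorm_mul]
  ring

/-- Localise `F₃`, estimate each local product by `wq_mulS_le`, spend `e^(-2στ)` on the Wiener norm,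
and integrate the remaining local weighted norm over `τ`. -/
theorem exists_wq_mul_le (A : ℝ≥0) (M : ℕ) {N : ℕ} (hN : 1 ≤ N) {σ : ℝ}
    (hσ : 2 * σ = 2 * N - 1) :
    ∃ C : ℝ≥0, ∀ w, IsWeight A M N w → ∀ F₁ F₂ F₃ : 𝓢(ℝ, ℂ),
      (∀ u, F₃ u = (Real.exp (-σ * u) : ℝ) * (F₁ u * F₂ u)) →
      wq w F₃ ≤ C * ((lq σ F₁ + wq w F₁) * wq w F₂ + (lq σ F₂ + wq w F₂) * wq w F₁) := by
  obtain ⟨C₁, hC₁⟩ := exists_fourierL1_window_le A M hN hσ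
  have hχ : mulS (window σ) (window 0) ≠ 0 := fun h => by
    have := DFunLike.congr_fun h 0
    simp [window_apply, bump_zero] at this
  obtain ⟨C₂, hC₂⟩ := exists_wq_le_lintegral A M hχ
  set K : ℝ≥0∞ := A ^ 2 * ∫⁻ ξ, ((1 + ‖ξ‖ₑ) ^ M * ‖𝓕 (window σ) ξ‖ₑ) ^ 2 with hK
  have hKt : K ≠ ⊤ := by
    have := (lintegral_pow_mul_enorm_sq_lt_top M (𝓕 (window σ))).ne
    finiteness
  set c : ℝ≥0∞ := C₂ * (2 * A ^ 2) * C₁ * K with hc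
  have hct : c ≠ ⊤ := by finiteness
  refine ⟨c.toNNReal, fun w hw F₁ F₂ F₃ hF => ?_⟩
  rw [ENNReal.coe_toNNReal hct]
  have hw1 := hw.lintegral_wq_shift_mul_le (window σ)
  rw [← hK] at hw1
  set B₁ := lq σ F₁ + wq w F₁
  set B₂ := lq σ F₂ + wq w F₂
  have hm : ∀ F, Measurable fun τ => wq w (mulS (shift τ (window σ)) F) := by
    intro F
    have := (continuous_fourier_shift_mul (window σ) F).measurable
    exact Measurable.lintegral_prod_right'
      (f := fun p : ℝ × ℝ => (w p.2 * ‖𝓕 (mulS (shift p.1 (window σ)) F) p.2‖ₑ) ^ 2)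
      (((hw.meas.comp measurable_snd).mul this.enorm).pow_const 2)
  have key : ∀ τ, wq w (mulS (shift τ (mulS (window σ) (window 0))) F₃) ≤
      2 * A ^ 2 * C₁ * (B₂ * wq w (mulS (shift τ (window σ)) F₁)
        + B₁ * wq w (mulS (shift τ (window σ)) F₂)) := by
    intro τ
    set G₁ := mulS (shift τ (window σ)) F₁ with hG₁
    set G₂ := mulS (shift τ (window σ)) F₂ with hG₂
    -- The window for `F₃` is chosen so that it splits into `window σ` on each factor: `-σ(u-τ) - σu
    -- = -στ - 2σ(u-τ)`. Only the scalar `e^(-στ)` is left of the unbounded exponential.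
    have e : mulS (shift τ (mulS (window σ) (window 0))) F₃
        = ((Real.exp (-σ * τ) : ℝ) : ℂ) • mulS G₁ G₂ := by
      ext u
      simp only [mulS_apply, shift_apply, window_apply, hG₁, hG₂, hF, smul_apply,
        smul_eq_mul]
      have : (Real.exp (-σ * (u - τ)) : ℝ) * Real.exp (-σ * u)
          = Real.exp (-σ * τ) * (Real.exp (-σ * (u - τ)) * Real.exp (-σ * (u - τ))) := by
        rw [← Real.exp_add, ← Real.exp_add, ← Real.exp_add]
        congr 1; ring
      have h' := congrArg (fun x : ℝ => (x : ℂ)) this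
      push_cast at h' ⊢
      simp only [neg_zero, zero_mul, Complex.exp_zero, one_mul]
      linear_combination (bump (u - τ) : ℂ) ^ 2 * F₁ u * F₂ u * h'
    have hexp : ‖((Real.exp (-σ * τ) : ℝ) : ℂ)‖ₑ ^ 2 = ENNReal.ofReal (Real.exp (-2 * σ * τ)) := by
      rw [enorm_ofReal_sq, ← Real.exp_nat_mul]
      congr 2; push_cast; ring
    rw [e, wq_smul, hexp]
    have a₁ := hC₁ w hw F₁ τ
    have a₂ := hC₁ w hw F₂ τ
    calc _ ≤ ENNReal.ofReal (Real.exp (-2 * σ * τ)) *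
          (2 * A ^ 2 * (wq w G₁ * fourierL1 0 G₂ ^ 2 + fourierL1 0 G₁ ^ 2 * wq w G₂)) := by
          gcongr; exact hw.wq_mulS_le G₁ G₂
      _ = 2 * A ^ 2 * (wq w G₁ * (ENNReal.ofReal (Real.exp (-2 * σ * τ)) * fourierL1 0 G₂ ^ 2)
          + (ENNReal.ofReal (Real.exp (-2 * σ * τ)) * fourierL1 0 G₁ ^ 2) * wq w G₂) := by ring
      _ ≤ 2 * A ^ 2 * (wq w G₁ * (C₁ * B₂) + (C₁ * B₁) * wq w G₂) := by gcongr
      _ = _ := by ring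
  calc wq w F₃ ≤ C₂ * ∫⁻ τ, wq w (mulS (shift τ (mulS (window σ) (window 0))) F₃) := hC₂ N w hw F₃
    _ ≤ C₂ * ∫⁻ τ, 2 * A ^ 2 * C₁ * (B₂ * wq w (mulS (shift τ (window σ)) F₁)
        + B₁ * wq w (mulS (shift τ (window σ)) F₂)) := by gcongr with τ; exact key τ
    _ = C₂ * (2 * A ^ 2 * C₁ * (B₂ * (∫⁻ τ, wq w (mulS (shift τ (window σ)) F₁))
        + B₁ * ∫⁻ τ, wq w (mulS (shift τ (window σ)) F₂))) := by
        rw [lintegral_const_mul' _ _ (by finiteness), lintegral_add_left ((hm F₁).const_mul _),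
          lintegral_const_mul _ (hm F₁), lintegral_const_mul _ (hm F₂)]
    _ ≤ C₂ * (2 * A ^ 2 * C₁ * (B₂ * (K * wq w F₁) + B₁ * (K * wq w F₂))) := by
        gcongr
        · exact hw1 F₁
        · exact hw1 F₂
    _ = _ := by rw [hc]; ring

/-! ### Bounded smooth multipliers -/

theorem abs_pow_mul_norm_fourier_le (F : 𝓢(ℝ, ℂ)) (n : ℕ) {B : ℝ}
    (hB : ∫ u, ‖iteratedDeriv n F u‖ ≤ B) (ξ : ℝ) : |ξ| ^ n * ‖𝓕 F ξ‖ ≤ B := by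
  have hi : ∀ m : ℕ, Integrable (iteratedDeriv m F) := fun m => by
    have := F.integrable_pow_mul_iteratedFDeriv volume 0 m
    simp only [pow_zero, one_mul, norm_iteratedFDeriv_eq_norm_iteratedDeriv] at this
    refine (integrable_norm_iff ?_).1 this
    exact ((F.smooth m).continuous_iteratedDeriv m le_rfl).aestronglyMeasurable
  have h := congrFun (Real.fourier_iteratedDeriv (N := ⊤) (n := n) (F.smooth ⊤) (fun m _ => hi m)
    le_top) ξ
  have h1 : ‖𝓕 (iteratedDeriv n F) ξ‖ ≤ B := by
    rw [Real.fourier_eq]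
    refine (norm_integral_le_integral_norm _).trans (le_trans (le_of_eq ?_) hB)
    simp
  rw [h, norm_smul, norm_pow] at h1
  refine le_trans ?_ h1
  rw [SchwartzMap.fourier_coe]
  gcongr
  simp only [Complex.norm_mul, Complex.norm_ofNat, Complex.norm_real, Complex.norm_I,
    Real.norm_eq_abs, abs_of_pos Real.pi_pos]
  have := Real.two_le_pi
  nlinarith [abs_nonneg ξ]

/-- Leibniz bounds the derivatives of `h ψ(· - τ)` in `L¹`, uniformly in `τ` by translation
invariance. Taking `M + 2` derivatives leaves the integrable factor `(1 + |ξ|)^(-2)` after paying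
for the weight. -/
theorem exists_fourierL1_mul_shift_le {h : ℝ → ℂ} (hs : ContDiff ℝ ∞ h)
    (hb : ∀ n : ℕ, ∃ C, ∀ u, ‖iteratedDeriv n h u‖ ≤ C) (ψ : 𝓢(ℝ, ℂ)) (M : ℕ) :
    ∃ C : ℝ≥0, ∀ (τ : ℝ) (H : 𝓢(ℝ, ℂ)), (∀ u, H u = h u * ψ (u - τ)) → fourierL1 M H ≤ C := by
  choose c hc using hb
  have hiψ : ∀ m : ℕ, Integrable fun u => ‖iteratedDeriv m ψ u‖ := fun m => by
    have := ψ.integrable_pow_mul_iteratedFDeriv volume 0 m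
    simpa only [pow_zero, one_mul, norm_iteratedFDeriv_eq_norm_iteratedDeriv] using this
  set B : ℕ → ℝ := fun n =>
    ∑ i ∈ Finset.range (n + 1), (n.choose i : ℝ) * c i * ∫ u, ‖iteratedDeriv (n - i) ψ u‖ with hB
  have hbound : ∀ (τ : ℝ) (H : 𝓢(ℝ, ℂ)), (∀ u, H u = h u * ψ (u - τ)) → ∀ n : ℕ,
      ∫ u, ‖iteratedDeriv n H u‖ ≤ B n := by
    intro τ H hH n
    have hHf : (H : ℝ → ℂ) = h * fun u => ψ (u - τ) := funext hH
    have hψs : ContDiff ℝ ∞ fun u => ψ (u - τ) := (ψ.smooth ⊤).comp (contDiff_id.sub contDiff_const)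
    have hint : ∀ i, Integrable fun u =>
        (n.choose i : ℝ) * c i * ‖iteratedDeriv (n - i) ψ (u - τ)‖ :=
      fun i => ((hiψ (n - i)).comp_sub_right τ).const_mul _
    have e : B n = ∫ u, ∑ i ∈ Finset.range (n + 1),
        (n.choose i : ℝ) * c i * ‖iteratedDeriv (n - i) ψ (u - τ)‖ := by
      rw [integral_finsetSum _ fun i _ => hint i]
      refine Finset.sum_congr rfl fun i _ => ?_
      rw [integral_const_mul, integral_sub_right_eq_self fun u => ‖iteratedDeriv (n - i) ψ u‖]
    rw [e]
    refine integral_mono_of_nonneg (ae_of_all _ fun u => norm_nonneg _)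
      (integrable_finsetSum _ fun i _ => hint i) (ae_of_all _ fun u => ?_)
    simp only []
    rw [hHf, iteratedDeriv_mul ((hs.of_le (mod_cast le_top)).contDiffAt)
      ((hψs.of_le (mod_cast le_top)).contDiffAt)]
    refine (norm_sum_le _ _).trans (Finset.sum_le_sum fun i _ => ?_)
    rw [norm_mul, norm_mul, iteratedDeriv_comp_sub_const]
    simp only [Complex.norm_natCast]
    gcongr
    exact hc i u
  set K : ℝ := 2 ^ (M + 2) * (B 0 + B (M + 2)) with hK
  refine ⟨(ENNReal.ofReal K * ENNReal.ofReal (2 * Real.pi)).toNNReal, fun τ H hH => ?_⟩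
  rw [ENNReal.coe_toNNReal (by finiteness), ← lintegral_ofReal_two_mul_inv_le one_pos,
    ← lintegral_const_mul _ (by fun_prop)]
  refine lintegral_mono fun ξ => ?_
  have h0 := abs_pow_mul_norm_fourier_le H 0 (hbound τ H hH 0) ξ
  have h2 := abs_pow_mul_norm_fourier_le H (M + 2) (hbound τ H hH (M + 2)) ξ
  have hKξ : (1 + |ξ|) ^ (M + 2) * ‖𝓕 H ξ‖ ≤ K := by
    have : (1 + |ξ|) ^ (M + 2) ≤ 2 ^ (M + 2) * (1 + |ξ| ^ (M + 2)) := by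
      refine (add_pow_le (by norm_num) (abs_nonneg ξ) (M + 2)).trans ?_
      rw [one_pow]
      gcongr
      · norm_num
      · omega
    calc _ ≤ 2 ^ (M + 2) * (1 + |ξ| ^ (M + 2)) * ‖𝓕 H ξ‖ := by gcongr
      _ = 2 ^ (M + 2) * (|ξ| ^ 0 * ‖𝓕 H ξ‖ + |ξ| ^ (M + 2) * ‖𝓕 H ξ‖) := by ring
      _ ≤ _ := by rw [hK]; gcongr
  have e1 : (1 + ‖ξ‖ₑ) ^ M * ‖𝓕 H ξ‖ₑ = ENNReal.ofReal ((1 + |ξ|) ^ M * ‖𝓕 H ξ‖) := by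
    rw [ENNReal.ofReal_mul (by positivity), ENNReal.ofReal_pow (by positivity),
      ENNReal.ofReal_add (by positivity) (by positivity), ← Real.norm_eq_abs]
    simp only [ofReal_norm, ENNReal.ofReal_one]
  have hK0 : 0 ≤ K := le_trans (by positivity) hKξ
  rw [e1, ← ENNReal.ofReal_mul hK0]
  refine ENNReal.ofReal_le_ofReal ?_
  rw [div_one, inv_one, mul_one, ← mul_assoc, ← div_eq_mul_inv, le_div_iff₀ (by positivity)]
  have h3 : 1 + ξ ^ 2 ≤ (1 + |ξ|) ^ 2 := by nlinarith [abs_nonneg ξ, sq_abs ξ]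
  calc _ ≤ (1 + |ξ|) ^ M * ‖𝓕 H ξ‖ * (1 + |ξ|) ^ 2 := by gcongr
    _ = (1 + |ξ|) ^ (M + 2) * ‖𝓕 H ξ‖ := by ring
    _ ≤ K * 2 := by linarith

/-- A merely bounded `h` need not have an integrable Fourier transform, but its localisations do.
The window is a square: one copy cuts off `h`, the other `F`. -/
theorem exists_wq_multiplier_le (A : ℝ≥0) (M : ℕ) {h : ℝ → ℂ} (hs : ContDiff ℝ ∞ h)
    (hb : ∀ n : ℕ, ∃ C, ∀ u, ‖iteratedDeriv n h u‖ ≤ C) :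
    ∃ C : ℝ≥0, ∀ (N : ℕ) (w : ℝ → ℝ≥0∞), IsWeight A M N w → ∀ F F₃ : 𝓢(ℝ, ℂ),
      (∀ u, F₃ u = h u * F u) → wq w F₃ ≤ C * wq w F := by
  have hχ : mulS (window 0) (window 0) ≠ 0 := fun h => by
    have := DFunLike.congr_fun h 0
    simp [window_apply, bump_zero] at this
  obtain ⟨C₁, hC₁⟩ := exists_wq_le_lintegral A M hχ
  obtain ⟨C₂, hC₂⟩ := exists_fourierL1_mul_shift_le hs hb (window 0) M
  set K : ℝ≥0∞ := A ^ 2 * ∫⁻ ξ, ((1 + ‖ξ‖ₑ) ^ M * ‖𝓕 (window 0) ξ‖ₑ) ^ 2 with hK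
  have hKt : K ≠ ⊤ := by
    have := (lintegral_pow_mul_enorm_sq_lt_top M (𝓕 (window 0))).ne
    finiteness
  have hg : Function.HasTemperateGrowth h := ⟨hs, fun n => by
    obtain ⟨C, hC⟩ := hb n
    exact ⟨0, C, fun u => by simpa [norm_iteratedFDeriv_eq_norm_iteratedDeriv] using hC u⟩⟩
  refine ⟨(C₁ * (A ^ 2 * C₂ ^ 2) * K).toNNReal, fun N w hw F F₃ hF => ?_⟩
  rw [ENNReal.coe_toNNReal (by finiteness)]
  refine (hC₁ N w hw F₃).trans ?_
  rw [mul_assoc, mul_assoc]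
  gcongr
  refine le_trans (lintegral_mono fun τ => ?_)
    ((lintegral_const_mul' (A ^ 2 * C₂ ^ 2 : ℝ≥0∞) _ (by finiteness)).trans_le
      (mul_le_mul_right (hw.lintegral_wq_shift_mul_le (window 0) F) _))
  set H : 𝓢(ℝ, ℂ) := SchwartzMap.smulLeftCLM ℂ h (shift τ (window 0)) with hH
  have hHu : ∀ u, H u = h u * window 0 (u - τ) := fun u => by
    rw [hH, SchwartzMap.smulLeftCLM_apply_apply hg, shift_apply, smul_eq_mul]
  have e : mulS (shift τ (mulS (window 0) (window 0))) F₃ = mulS H (mulS (shift τ (window 0)) F) := by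
    ext u
    simp only [mulS_apply, shift_apply, hHu, hF]
    ring
  rw [e]
  refine (hw.wq_mulS_le_fourierL1 _ _).trans ?_
  gcongr
  exact hC₂ τ H hHu

end

section

/-! ### Test functions and their Taylor coefficients -/

variable {f g h : ℝ → ℝ} {n : ℕ}

theorem IsTest.contDiffWithinAt (hf : IsTest f) (m : ℕ) {x : ℝ} (hx : 0 ≤ x) :
    ContDiffWithinAt ℝ m f (Ici 0) x :=
  (hf.smooth x hx).of_le (mod_cast le_top)

theorem IsTest.add (hf : IsTest f) (hg : IsTest g) : IsTest fun x => f x + g x := by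
  obtain ⟨R, hR⟩ := hf.eventually_zero
  obtain ⟨S, hS⟩ := hg.eventually_zero
  exact ⟨hf.smooth.add hg.smooth, max R S, fun x hx => by
    simp [hR x (le_of_max_le_left hx), hS x (le_of_max_le_right hx)]⟩

theorem IsTest.const_mul (hf : IsTest f) (c : ℝ) : IsTest fun x => c * f x := by
  obtain ⟨R, hR⟩ := hf.eventually_zero
  exact ⟨contDiffOn_const.mul hf.smooth, R, fun x hx => by simp [hR x hx]⟩

theorem IsTest.sub (hf : IsTest f) (hg : IsTest g) : IsTest fun x => f x - g x := by
  simpa [sub_eq_add_neg] using hf.add (hg.const_mul (-1))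

theorem IsTest.smooth_mul (hf : IsTest f) (hg : ContDiffOn ℝ ∞ g (Ici 0)) :
    IsTest fun x => f x * g x := by
  obtain ⟨R, hR⟩ := hf.eventually_zero
  exact ⟨hf.smooth.mul hg, R, fun x hx => by simp [hR x hx]⟩

theorem IsTest.mul (hf : IsTest f) (hg : IsTest g) : IsTest fun x => f x * g x :=
  hf.smooth_mul hg.smooth

theorem IsTest.zero : IsTest fun _ => 0 := ⟨contDiffOn_const, 0, fun _ _ => rfl⟩

theorem IsTest.sum {ι : Type*} (s : Finset ι) {F : ι → ℝ → ℝ} (hF : ∀ i ∈ s, IsTest (F i)) :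
    IsTest fun x => ∑ i ∈ s, F i x := by
  classical
  induction s using Finset.induction_on with
  | empty => simpa using IsTest.zero
  | insert a s ha ih =>
    simp only [Finset.sum_insert ha]
    exact (hF a (by simp)).add (ih fun i hi => hF i (by simp [hi]))

theorem IsTest.derivWithin (hf : IsTest f) : IsTest (derivWithin f (Ici 0)) := by
  obtain ⟨R, hR⟩ := hf.eventually_zero
  refine ⟨hf.smooth.derivWithin (uniqueDiffOn_Ici 0) le_rfl, max R 0 + 1, fun x hx => ?_⟩
  have h1 : R < x := by linarith [le_max_left R 0]
  have : f =ᶠ[𝓝[Ici 0] x] fun _ => (0 : ℝ) := by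
    filter_upwards [mem_nhdsWithin_of_mem_nhds (Ioi_mem_nhds h1)] with y hy
    exact hR y (le_of_lt hy)
  rw [this.derivWithin_eq (hR x h1.le)]
  simp

theorem IsTest.hasDerivWithinAt (hf : IsTest f) {x : ℝ} (hx : 0 ≤ x) :
    HasDerivWithinAt f (_root_.derivWithin f (Ici 0) x) (Ici 0) x :=
  ((hf.contDiffWithinAt 1 hx).differentiableWithinAt (by simp)).hasDerivWithinAt

theorem IsTest.exists_bound (hf : IsTest f) : ∃ C, ∀ x, 0 ≤ x → |f x| ≤ C := by
  obtain ⟨R, hR⟩ := hf.eventually_zero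
  obtain ⟨C, hC⟩ := (isCompact_Icc (a := (0 : ℝ)) (b := R)).exists_bound_of_continuousOn
    (hf.smooth.continuousOn.mono Icc_subset_Ici_self)
  refine ⟨max C 0, fun x hx => ?_⟩
  rcases le_total x R with h | h
  · exact (hC x ⟨hx, h⟩).trans (le_max_left _ _)
  · simp [hR x h]

/-- The one-sided derivatives at the origin. -/
noncomputable def jet (m : ℕ) (f : ℝ → ℝ) : ℝ := iteratedDerivWithin m f (Ici 0) 0

theorem taylorCoeff_eq (f : ℝ → ℝ) (m : ℕ) : taylorCoeff f m = jet m f / m.factorial := rfl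

theorem jet_succ (m : ℕ) (f : ℝ → ℝ) : jet (m + 1) f = jet m (derivWithin f (Ici 0)) := by
  rw [jet, iteratedDerivWithin_succ', jet]

theorem IsTest.jet_add (hf : IsTest f) (hg : IsTest g) (m : ℕ) :
    jet m (fun x => f x + g x) = jet m f + jet m g :=
  iteratedDerivWithin_fun_add self_mem_Ici (uniqueDiffOn_Ici 0)
    (hf.contDiffWithinAt m le_rfl) (hg.contDiffWithinAt m le_rfl)

theorem jet_const_mul (c : ℝ) (f : ℝ → ℝ) (m : ℕ) : jet m (fun x => c * f x) = c * jet m f := by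
  simp [jet]

theorem IsTest.jet_sub (hf : IsTest f) (hg : IsTest g) (m : ℕ) :
    jet m (fun x => f x - g x) = jet m f - jet m g := by
  have := hf.jet_add (hg.const_mul (-1)) m
  rw [jet_const_mul] at this
  simpa [sub_eq_add_neg] using this

theorem IsTest.jet_sum {ι : Type*} (s : Finset ι) {F : ι → ℝ → ℝ} (hF : ∀ i ∈ s, IsTest (F i))
    (m : ℕ) : jet m (fun x => ∑ i ∈ s, F i x) = ∑ i ∈ s, jet m (F i) := by
  classical
  induction s using Finset.induction_on with
  | empty => simp [jet]
  | insert a s ha ih =>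
    simp only [Finset.sum_insert ha]
    rw [(hF a (by simp)).jet_add (IsTest.sum s fun i hi => hF i (by simp [hi])),
      ih fun i hi => hF i (by simp [hi])]

/-- A test function which vanishes to order `n` at the origin. -/
structure IsFlat (n : ℕ) (h : ℝ → ℝ) : Prop where
  test : IsTest h
  jet_eq_zero : ∀ m < n, jet m h = 0

theorem IsTest.isFlat_zero (hf : IsTest f) : IsFlat 0 f := ⟨hf, fun _ hm => absurd hm (by simp)⟩

theorem IsFlat.sub (hf : IsFlat n f) (hg : IsFlat n g) : IsFlat n fun x => f x - g x :=
  ⟨hf.test.sub hg.test, fun m hm => by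
    rw [hf.test.jet_sub hg.test, hf.jet_eq_zero m hm, hg.jet_eq_zero m hm, sub_zero]⟩

theorem IsFlat.const_mul (hf : IsFlat n f) (c : ℝ) : IsFlat n fun x => c * f x :=
  ⟨hf.test.const_mul c, fun m hm => by rw [jet_const_mul, hf.jet_eq_zero m hm, mul_zero]⟩

theorem IsFlat.mul (hf : IsFlat n f) (hg : IsTest g) : IsFlat n fun x => f x * g x := by
  refine ⟨hf.test.mul hg, fun m hm => ?_⟩
  have := iteratedDerivWithin_mul (n := m) (x := (0 : ℝ)) self_mem_Ici (uniqueDiffOn_Ici 0)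
    (hf.test.contDiffWithinAt m le_rfl) (hg.contDiffWithinAt m le_rfl)
  refine this.trans (Finset.sum_eq_zero fun i hi => ?_)
  have h0 := hf.jet_eq_zero i (lt_of_le_of_lt (Nat.lt_succ_iff.1 (Finset.mem_range.1 hi)) hm)
  rw [jet] at h0
  rw [h0]; ring

theorem IsFlat.derivWithin (hf : IsFlat (n + 1) f) : IsFlat n (derivWithin f (Ici 0)) :=
  ⟨hf.test.derivWithin, fun m hm => by rw [← jet_succ]; exact hf.jet_eq_zero _ (by omega)⟩

/-- The operator `σ - x d/dx`. -/
noncomputable def eulerOp (σ : ℝ) (f : ℝ → ℝ) (x : ℝ) : ℝ :=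
  σ * f x - derivWithin f (Ici 0) x * x

theorem IsFlat.eulerOp (hf : IsFlat n f) (σ : ℝ) : IsFlat n (eulerOp σ f) := by
  refine (hf.const_mul σ).sub (g := fun x => _root_.derivWithin f (Ici 0) x * x)
    ⟨hf.test.derivWithin.smooth_mul contDiffOn_id, fun m hm => ?_⟩
  have := iteratedDerivWithin_mul (n := m) (x := (0 : ℝ)) (g := fun x : ℝ => x)
    self_mem_Ici (uniqueDiffOn_Ici 0)
    (hf.test.derivWithin.contDiffWithinAt m le_rfl) contDiffWithinAt_id
  refine this.trans (Finset.sum_eq_zero fun i hi => ?_)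
  have hi' := Nat.lt_succ_iff.1 (Finset.mem_range.1 hi)
  -- The term `i = m` involves the jet of order `m + 1`, which need not vanish; there the
  -- undifferentiated factor `x` is zero at the origin.
  rcases hi'.eq_or_lt with rfl | hlt
  · simp
  · have h0 := hf.jet_eq_zero (i + 1) (by omega)
    rw [jet_succ, jet] at h0
    rw [h0]; ring

theorem IsFlat.exists_bound (hf : IsFlat n f) : ∃ C, ∀ x, 0 ≤ x → |f x| ≤ C * x ^ n := by
  induction n generalizing f with
  | zero => simpa using hf.test.exists_bound
  | succ n ih =>
    obtain ⟨C, hC⟩ := ih hf.derivWithin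
    have hf0 : f 0 = 0 := by simpa [jet] using hf.jet_eq_zero 0 (by omega)
    have hC0 : 0 ≤ C := by simpa using (abs_nonneg _).trans (hC 1 zero_le_one)
    refine ⟨C, fun x hx => ?_⟩
    have := (convex_Icc (0 : ℝ) x).norm_image_sub_le_of_norm_hasDerivWithin_le (f := f)
      (C := C * x ^ n) (fun y hy => (hf.test.hasDerivWithinAt hy.1).mono Icc_subset_Ici_self)
      (fun y hy => (hC y hy.1).trans (mul_le_mul_of_nonneg_left
        (pow_le_pow_left₀ hy.1 hy.2 n) hC0)) ⟨le_rfl, hx⟩ ⟨hx, le_rfl⟩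
    rw [hf0, sub_zero, sub_zero, Real.norm_eq_abs, Real.norm_eq_abs, abs_of_nonneg hx] at this
    rwa [pow_succ, ← mul_assoc]

/-! ### Logarithmic coordinates -/

/-- The function `u ↦ e^(σu) f (e^(-u))`. -/
noncomputable def logLift (σ : ℝ) (f : ℝ → ℝ) (u : ℝ) : ℂ :=
  ((Real.exp (σ * u) * f (Real.exp (-u)) : ℝ) : ℂ)

/-- In the variable `u`, differentiation is the operator `σ - x d/dx`, which preserves flatness.
Every derivative of a lift is thus a lift of the same kind, and smoothness and decay need checking
only at order zero. -/
theorem IsTest.hasDerivAt_logLift (hf : IsTest f) (σ u : ℝ) :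
    HasDerivAt (logLift σ f) (logLift σ (WeightedX.eulerOp σ f) u) u := by
  have h1 : HasDerivAt f (_root_.derivWithin f (Ici 0) (Real.exp (-u))) (Real.exp (-u)) :=
    (hf.hasDerivWithinAt (Real.exp_nonneg _)).hasDerivAt (Ici_mem_nhds (Real.exp_pos _))
  have h2 : HasDerivAt (fun u => Real.exp (-u)) (-Real.exp (-u)) u := by
    simpa using (hasDerivAt_neg u).exp
  have h3 : HasDerivAt (fun u => Real.exp (σ * u)) (Real.exp (σ * u) * σ) u := by
    simpa using ((hasDerivAt_id u).const_mul σ).exp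
  have h4 := (h3.mul (h1.comp u h2)).ofReal_comp
  refine h4.congr_deriv ?_
  simp only [logLift, WeightedX.eulerOp, Function.comp]
  congr 1
  ring

theorem IsTest.iteratedDeriv_logLift (hf : IsTest f) (σ : ℝ) (m : ℕ) :
    iteratedDeriv m (logLift σ f) = logLift σ ((WeightedX.eulerOp σ)^[m] f) := by
  induction m generalizing f with
  | zero => simp
  | succ m ih =>
    rw [iteratedDeriv_succ', Function.iterate_succ_apply]
    have : deriv (logLift σ f) = logLift σ (WeightedX.eulerOp σ f) :=
      funext fun u => (hf.hasDerivAt_logLift σ u).deriv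
    rw [this, ih (hf.isFlat_zero.eulerOp σ).test]

theorem IsFlat.eulerOp_iterate (hf : IsFlat n f) (σ : ℝ) (m : ℕ) :
    IsFlat n ((WeightedX.eulerOp σ)^[m] f) := by
  induction m generalizing f with
  | zero => simpa
  | succ m ih => rw [Function.iterate_succ_apply]; exact ih (hf.eulerOp σ)

theorem IsTest.contDiff_logLift (hf : IsTest f) (σ : ℝ) : ContDiff ℝ ∞ (logLift σ f) := by
  refine contDiff_of_differentiable_iteratedDeriv (n := ⊤) fun m _ => ?_
  rw [hf.iteratedDeriv_logLift]
  exact fun u => ((hf.isFlat_zero.eulerOp_iterate σ m).test.hasDerivAt_logLift σ u).differentiableAt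

theorem norm_logLift (σ : ℝ) (f : ℝ → ℝ) (u : ℝ) :
    ‖logLift σ f u‖ = Real.exp (σ * u) * |f (Real.exp (-u))| := by
  rw [logLift, Complex.norm_real, Real.norm_eq_abs, abs_mul, abs_of_pos (Real.exp_pos _)]

theorem IsTest.exists_iteratedDeriv_logLift_bound (hf : IsTest f) (m : ℕ) :
    ∃ C, ∀ u, ‖iteratedDeriv m (logLift 0 f) u‖ ≤ C := by
  obtain ⟨C, hC⟩ := (hf.isFlat_zero.eulerOp_iterate 0 m).test.exists_bound
  refine ⟨C, fun u => ?_⟩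
  rw [hf.iteratedDeriv_logLift, norm_logLift]
  simpa using hC _ (Real.exp_nonneg _)

/-- Flatness gives decay like `e^(-(n-σ)u)` as `u → +∞`; the lift vanishes for very negative `u`
because `f` vanishes for large `x`. -/
theorem IsFlat.exists_logLift_decay (hf : IsFlat n f) {σ : ℝ} (hσ : σ < n) (j : ℕ) :
    ∃ C, ∀ u, |u| ^ j * ‖logLift σ f u‖ ≤ C := by
  obtain ⟨C, hC⟩ := hf.exists_bound
  obtain ⟨R, hR⟩ := hf.test.eventually_zero
  have hC0 : 0 ≤ C := by simpa using (abs_nonneg _).trans (hC 1 zero_le_one)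
  set δ := (n : ℝ) - σ with hδ
  have hδ0 : 0 < δ := by rw [hδ]; linarith
  have hb : ∀ u, ‖logLift σ f u‖ ≤ C * Real.exp (-δ * u) := fun u => by
    rw [norm_logLift]
    calc _ ≤ Real.exp (σ * u) * (C * Real.exp (-u) ^ n) := by
          gcongr; exact hC _ (Real.exp_nonneg _)
      _ = C * (Real.exp (σ * u) * Real.exp (-u) ^ n) := by ring
      _ = _ := by
          rw [← Real.exp_nat_mul, ← Real.exp_add]
          congr 2; rw [hδ]; ring
  -- The maximum with `1` keeps `log S` nonnegative whatever the sign of `R`.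
  set S := max R 1 with hS
  have hlog : 0 ≤ Real.log S := Real.log_nonneg (le_max_right _ _)
  refine ⟨max (C * (j.factorial / δ ^ j)) (Real.log S ^ j * (C * Real.exp (δ * Real.log S))),
    fun u => ?_⟩
  rcases le_total 0 u with hu | hu
  · refine le_trans ?_ (le_max_left _ _)
    rw [abs_of_nonneg hu]
    have h1 := Real.pow_div_factorial_le_exp (δ * u) (by positivity) j
    rw [div_le_iff₀ (by positivity), mul_pow] at h1
    calc u ^ j * ‖logLift σ f u‖ ≤ u ^ j * (C * Real.exp (-δ * u)) := by gcongr; exact hb u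
      _ = C * (δ ^ j * u ^ j * Real.exp (-δ * u) / δ ^ j) := by field_simp
      _ ≤ C * (Real.exp (δ * u) * j.factorial * Real.exp (-δ * u) / δ ^ j) := by gcongr
      _ = C * (j.factorial * (Real.exp (δ * u) * Real.exp (-δ * u)) / δ ^ j) := by ring
      _ = _ := by rw [← Real.exp_add]; simp
  · refine le_trans ?_ (le_max_right _ _)
    rcases le_total R (Real.exp (-u)) with h | h
    · rw [norm_logLift, hR _ h]
      simp only [abs_zero, mul_zero]
      positivity
    · have h2 : -u ≤ Real.log S := by
        rw [Real.le_log_iff_exp_le (by positivity)]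
        exact h.trans (le_max_left _ _)
      rw [abs_of_nonpos hu]
      refine mul_le_mul (pow_le_pow_left₀ (by linarith) h2 j) ((hb u).trans ?_)
        (norm_nonneg _) (by positivity)
      gcongr C * ?_
      rw [Real.exp_le_exp]
      nlinarith

/-- The Schwartz function `u ↦ e^(σu) f (e^(-u))` for a test function `f` vanishing at the origin to
an order `n > σ`. -/
noncomputable def IsFlat.lift (hf : IsFlat n f) {σ : ℝ} (hσ : σ < n) : 𝓢(ℝ, ℂ) where
  toFun := logLift σ f
  smooth' := hf.test.contDiff_logLift σ
  decay' j m := by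
    obtain ⟨C, hC⟩ := (hf.eulerOp_iterate σ m).exists_logLift_decay hσ j
    refine ⟨C, fun u => ?_⟩
    rw [norm_iteratedFDeriv_eq_norm_iteratedDeriv, hf.test.iteratedDeriv_logLift]
    exact hC u

theorem IsFlat.lift_apply (hf : IsFlat n f) {σ : ℝ} (hσ : σ < n) (u : ℝ) :
    hf.lift hσ u = logLift σ f u := rfl

/-! ### The Taylor remainder -/

variable {k : ℕ} {ζ : ℝ → ℝ}

theorem IsCutoff.isTest_mul_pow (hζ : IsCutoff ζ) (i : ℕ) : IsTest fun x => ζ x * x ^ i :=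
  IsTest.smooth_mul ⟨hζ.smooth, 1 / 4, hζ.eq_zero⟩ (contDiff_id.pow i).contDiffOn

theorem IsCutoff.jet_mul_pow (hζ : IsCutoff ζ) (i m : ℕ) :
    jet m (fun x => ζ x * x ^ i) = if m = i then (m.factorial : ℝ) else 0 := by
  have h1 : (fun x => ζ x * x ^ i) =ᶠ[𝓝[Ici 0] 0] fun x => x ^ i := by
    filter_upwards [self_mem_nhdsWithin,
      mem_nhdsWithin_of_mem_nhds (Iic_mem_nhds (show (0 : ℝ) < 1 / 8 by norm_num))] with x hx hx'
    rw [hζ.eq_one x ⟨hx, hx'⟩, one_mul]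
  rw [jet, h1.iteratedDerivWithin_eq (by simp [hζ.eq_one 0 (by norm_num)]),
    iteratedDerivWithin_pow self_mem_Ici (uniqueDiffOn_Ici 0)]
  split_ifs with h
  · subst h; simp [Nat.descFactorial_self]
  · rcases lt_or_gt_of_ne h with h | h
    · rw [zero_pow (by omega), mul_zero]
    · rw [Nat.descFactorial_of_lt h]; simp

theorem remainder_eq (k : ℕ) (ζ f : ℝ → ℝ) : remainder k ζ f =
    fun x => f x - ∑ i ∈ Finset.range (3 * k), taylorCoeff f i * (ζ x * x ^ i) := by
  ext x
  rw [remainder, taylorPoly, Finset.mul_sum]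
  congr 1
  exact Finset.sum_congr rfl fun i _ => by ring

theorem isFlat_remainder (hζ : IsCutoff ζ) (hf : IsTest f) : IsFlat (3 * k) (remainder k ζ f) := by
  have ht : ∀ i ∈ Finset.range (3 * k), IsTest fun x => taylorCoeff f i * (ζ x * x ^ i) :=
    fun i _ => (hζ.isTest_mul_pow i).const_mul _
  rw [remainder_eq]
  refine ⟨hf.sub (IsTest.sum _ ht), fun m hm => ?_⟩
  rw [hf.jet_sub (IsTest.sum _ ht), IsTest.jet_sum _ ht]
  simp_rw [jet_const_mul, hζ.jet_mul_pow]
  simp only [mul_ite, mul_zero, Finset.sum_ite_eq, Finset.mem_range, hm, if_true]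
  rw [taylorCoeff_eq, div_mul_cancel₀ _ (by positivity), sub_self]

theorem IsTest.taylorCoeff_add (hf : IsTest f) (hg : IsTest g) (m : ℕ) :
    taylorCoeff (fun x => f x + g x) m = taylorCoeff f m + taylorCoeff g m := by
  simp only [taylorCoeff_eq, hf.jet_add hg, add_div]

theorem taylorCoeff_const_mul (c : ℝ) (f : ℝ → ℝ) (m : ℕ) :
    taylorCoeff (fun x => c * f x) m = c * taylorCoeff f m := by
  simp only [taylorCoeff_eq, jet_const_mul, mul_div_assoc]

theorem IsTest.remainder_add (hf : IsTest f) (hg : IsTest g) (k : ℕ) (ζ : ℝ → ℝ) :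
    remainder k ζ (fun x => f x + g x) = fun x => remainder k ζ f x + remainder k ζ g x := by
  simp only [remainder_eq, hf.taylorCoeff_add hg, add_mul, Finset.sum_add_distrib]
  ext x; ring

theorem remainder_const_mul (c : ℝ) (k : ℕ) (ζ f : ℝ → ℝ) :
    remainder k ζ (fun x => c * f x) = fun x => c * remainder k ζ f x := by
  simp only [remainder_eq, taylorCoeff_const_mul, mul_assoc, mul_sub, Finset.mul_sum]

theorem IsFlat.taylorCoeff_eq_zero (hf : IsFlat n f) {m : ℕ} (hm : m < n) : taylorCoeff f m = 0 := by
  rw [taylorCoeff_eq, hf.jet_eq_zero m hm, zero_div]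

theorem IsFlat.remainder_eq_self (hf : IsFlat (3 * k) f) (ζ : ℝ → ℝ) : remainder k ζ f = f := by
  rw [remainder_eq]
  ext x
  rw [Finset.sum_eq_zero, sub_zero]
  intro i hi
  rw [hf.taylorCoeff_eq_zero (Finset.mem_range.1 hi), zero_mul]

theorem IsFlat.polyNorm_eq_zero (hf : IsFlat (3 * k) f) : polyNorm k f = 0 := by
  rw [polyNorm, Finset.sum_eq_zero, Real.sqrt_zero]
  intro i hi
  rw [hf.taylorCoeff_eq_zero (Finset.mem_range.1 hi)]
  norm_num

end

section

variable {f g h : ℝ → ℝ} {n k : ℕ} {ζ : ℝ → ℝ} {ε : ℝ}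

/-! ### The Mellin weight -/

/-- The weight `|λ|^(3k+1) μ^k` at `λ = linePt k (-2πξ)`. -/
noncomputable def mellinWeight (k : ℕ) (ε ξ : ℝ) : ℝ≥0∞ :=
  ENNReal.ofReal (‖linePt k (-(2 * Real.pi) * ξ)‖ ^ (3 * k + 1) *
    mu ε (linePt k (-(2 * Real.pi) * ξ)) ^ k)

/-- The radial profile `r^(3k+1) min(r, 1/ε)^k` of the weight. -/
noncomputable def profile (k : ℕ) (ε r : ℝ) : ℝ :=
  r ^ (3 * k + 1) * (if ε = 0 then r else min r (1 / ε)) ^ k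

theorem profile_mono (hε : 0 ≤ ε) {r s : ℝ} (hr : 0 ≤ r) (hrs : r ≤ s) :
    profile k ε r ≤ profile k ε s := by
  have hs := hr.trans hrs
  unfold profile
  split_ifs
  · gcongr
  · have : 0 ≤ min r (1 / ε) := le_min hr (by positivity)
    gcongr

/-- Since `c ≥ 1`, `min (cr) (1/ε) ≤ c min r (1/ε)`: a doubling bound that does not see `ε`. With
monotonicity it yields both growth properties of the weight. -/
theorem profile_mul_le (hε : 0 ≤ ε) {r c : ℝ} (hr : 0 ≤ r) (hc : 1 ≤ c) :
    profile k ε (c * r) ≤ c ^ (4 * k + 1) * profile k ε r := by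
  have hc0 : 0 ≤ c := by linarith
  have h : (if ε = 0 then c * r else min (c * r) (1 / ε))
      ≤ c * (if ε = 0 then r else min r (1 / ε)) := by
    split_ifs
    · exact le_rfl
    · have : (0 : ℝ) ≤ 1 / ε := by positivity
      rw [mul_min_of_nonneg _ _ hc0]
      exact min_le_min le_rfl (by nlinarith)
  have h0 : 0 ≤ (if ε = 0 then c * r else min (c * r) (1 / ε)) := by
    split_ifs
    · positivity
    · exact le_min (by positivity) (by positivity)
  calc profile k ε (c * r)
      ≤ (c * r) ^ (3 * k + 1) * (c * (if ε = 0 then r else min r (1 / ε))) ^ k := by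
        unfold profile; gcongr
    _ = _ := by
        unfold profile
        rw [mul_pow, mul_pow, show 4 * k + 1 = (3 * k + 1) + k by ring, pow_add]
        ring

theorem profile_nonneg (hε : 0 ≤ ε) {r : ℝ} (hr : 0 ≤ r) : 0 ≤ profile k ε r := by
  unfold profile
  split_ifs
  · positivity
  · have : 0 ≤ min r (1 / ε) := le_min hr (by positivity)
    positivity

theorem profile_le_pow (hε : 0 ≤ ε) {r : ℝ} (hr : 0 ≤ r) : profile k ε r ≤ r ^ (4 * k + 1) := by
  rw [show 4 * k + 1 = (3 * k + 1) + k by ring, pow_add]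
  unfold profile
  split_ifs
  · exact le_rfl
  · have : 0 ≤ min r (1 / ε) := le_min hr (by positivity)
    gcongr
    exact min_le_left _ _

/-- Here `ε ≤ 1` enters: it makes the truncated factor at least `1`. -/
theorem pow_le_profile (hε : 0 ≤ ε) (hε1 : ε ≤ 1) {r : ℝ} (hr : 1 ≤ r) :
    r ^ (3 * k) ≤ profile k ε r := by
  have h1 : 1 ≤ (if ε = 0 then r else min r (1 / ε)) := by
    split_ifs with h
    · exact hr
    · exact le_min hr (by
        rw [le_div_iff₀ (lt_of_le_of_ne hε (Ne.symm h))]; linarith)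
  calc r ^ (3 * k) ≤ r ^ (3 * k + 1) := pow_le_pow_right₀ hr (by omega)
    _ ≤ _ := le_mul_of_one_le_right (by positivity) (one_le_pow₀ h1)

theorem mellinWeight_eq (k : ℕ) (ε ξ : ℝ) :
    mellinWeight k ε ξ = ENNReal.ofReal (profile k ε ‖linePt k (-(2 * Real.pi) * ξ)‖) := rfl

theorem norm_linePt_add_le (k : ℕ) (s t : ℝ) : ‖linePt k (s + t)‖ ≤ ‖linePt k s‖ + |t| := by
  have : linePt k (s + t) = linePt k s + (t : ℂ) * Complex.I := by
    apply Complex.ext <;> simp [linePt]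
  rw [this]
  refine (norm_add_le _ _).trans (le_of_eq ?_)
  simp

theorem abs_le_norm_linePt (k : ℕ) (s : ℝ) : |s| ≤ ‖linePt k s‖ := Complex.abs_im_le_norm (linePt k s)

theorem le_norm_linePt (hk : 1 ≤ k) (s : ℝ) : 5 / 2 ≤ ‖linePt k s‖ := by
  refine le_trans ?_ (Complex.abs_re_le_norm (linePt k s))
  have : (1 : ℝ) ≤ k := by exact_mod_cast hk
  refine le_trans ?_ (le_abs_self _)
  simp only [linePt]
  linarith

theorem norm_linePt_zero_le (k : ℕ) : ‖linePt k 0‖ ≤ 3 * k + 3 := by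
  refine (Complex.norm_le_abs_re_add_abs_im _).trans ?_
  simp only [linePt, abs_zero, add_zero]
  rw [abs_le]
  constructor <;> linarith [(Nat.cast_nonneg k : (0 : ℝ) ≤ k)]

theorem ofReal_add_abs_pow (A : ℝ≥0) (M : ℕ) (η : ℝ) :
    (A : ℝ≥0∞) * (1 + ‖η‖ₑ) ^ M = ENNReal.ofReal (A * (1 + |η|) ^ M) := by
  rw [ENNReal.ofReal_mul (by positivity), ENNReal.ofReal_pow (by positivity),
    ENNReal.ofReal_add (by positivity) (by positivity), ← Real.norm_eq_abs]
  simp only [ofReal_norm, ENNReal.ofReal_one, ENNReal.ofReal_coe_nnreal]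

/-- All uniformity in `ε` rests on this. The norm of `λ` changes by at most a factor `3k + 3` in
each comparison, and the profile has degree at most `4k + 1`. -/
theorem isWeight_mellinWeight (hk : 1 ≤ k) (hε : 0 ≤ ε) (hε1 : ε ≤ 1) :
    IsWeight ((3 * k + 3 : ℝ≥0) ^ (4 * k + 1)) (4 * k + 1) (3 * k) (mellinWeight k ε) := by
  have hA : (((3 * k + 3 : ℝ≥0) ^ (4 * k + 1) : ℝ≥0) : ℝ) = (3 * k + 3 : ℝ) ^ (4 * k + 1) := by
    push_cast; rfl
  have hk0 : (0 : ℝ) ≤ k := Nat.cast_nonneg k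
  constructor
  · have h1 : Continuous fun ξ : ℝ => ‖linePt k (-(2 * Real.pi) * ξ)‖ := by
      have : Continuous (linePt k) := by
        have e : linePt k = fun s : ℝ => ((3 * (k : ℝ) - 1 / 2 : ℝ) : ℂ) + s * Complex.I := by
          ext s; apply Complex.ext <;> simp [linePt]
        rw [e]; fun_prop
      fun_prop
    have h2 : Measurable (profile k ε) := by
      unfold profile
      split_ifs <;> fun_prop
    exact (h2.comp h1.measurable).ennreal_ofReal
  · intro ξ η
    simp only [mellinWeight_eq]
    set r := ‖linePt k (-(2 * Real.pi) * ξ)‖ with hr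
    set s := ‖linePt k (-(2 * Real.pi) * η)‖ with hs
    have hr0 : 0 ≤ r := norm_nonneg _
    have hs0 : 0 ≤ s := norm_nonneg _
    rw [← ENNReal.ofReal_add (profile_nonneg hε hr0) (profile_nonneg hε hs0),
      ← ENNReal.ofReal_coe_nnreal, hA, ← ENNReal.ofReal_mul (by positivity)]
    refine ENNReal.ofReal_le_ofReal ?_
    have h1 : ‖linePt k (-(2 * Real.pi) * (ξ + η))‖ ≤ (3 * k + 3) * max r s := by
      rw [mul_add]
      refine (norm_linePt_add_le _ _ _).trans ?_
      have := abs_le_norm_linePt k (-(2 * Real.pi) * η)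
      have h2 : r ≤ max r s := le_max_left _ _
      have h3 : s ≤ max r s := le_max_right _ _
      have h4 : 0 ≤ max r s := hr0.trans h2
      nlinarith [mul_nonneg hk0 h4]
    calc profile k ε ‖linePt k (-(2 * Real.pi) * (ξ + η))‖
        ≤ profile k ε ((3 * k + 3) * max r s) := profile_mono hε (norm_nonneg _) h1
      _ ≤ (3 * k + 3) ^ (4 * k + 1) * profile k ε (max r s) :=
          profile_mul_le hε (le_max_of_le_left hr0) (by linarith)
      _ ≤ _ := by
          gcongr
          rcases max_cases r s with h | h <;> rw [h.1]
          · linarith [profile_nonneg (k := k) hε hs0]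
          · linarith [profile_nonneg (k := k) hε hr0]
  · intro ξ η
    simp only [mellinWeight_eq]
    set r := ‖linePt k (-(2 * Real.pi) * ξ)‖ with hr
    have hr0 : 0 ≤ r := norm_nonneg _
    rw [ofReal_add_abs_pow, ← ENNReal.ofReal_mul (by positivity), hA, ← mul_pow]
    refine ENNReal.ofReal_le_ofReal ?_
    have hη := abs_nonneg η
    refine (profile_mono hε (norm_nonneg _) ?_).trans (profile_mul_le hε hr0 ?_)
    · rw [mul_add]
      refine (norm_linePt_add_le _ _ _).trans ?_
      have h5 := le_norm_linePt hk (-(2 * Real.pi) * ξ)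
      rw [← hr] at h5
      rw [abs_mul, abs_neg, abs_of_pos Real.two_pi_pos, ← hr]
      -- The lower bound `|λ| ≥ 5/2` turns the additive increment `2π|η|` into a multiple of `|η|
      -- r`.
      have hpi := Real.pi_lt_d2
      have h6 : 2 * Real.pi * |η| ≤ 3 * (|η| * r) := by nlinarith [mul_nonneg hη (sub_nonneg.2 h5)]
      nlinarith [mul_nonneg hη hr0, mul_nonneg hk0 hr0, mul_nonneg hk0 (mul_nonneg hη hr0)]
    · nlinarith [mul_nonneg hk0 hη]
  · intro ξ
    rw [mellinWeight_eq, ← ofReal_norm, ← ENNReal.ofReal_pow (norm_nonneg _)]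
    refine ENNReal.ofReal_le_ofReal ?_
    refine le_trans ?_ (pow_le_profile hε hε1 ((by norm_num : (1 : ℝ) ≤ 5 / 2).trans
      (le_norm_linePt hk _)))
    refine pow_le_pow_left₀ (norm_nonneg _) (le_trans ?_ (abs_le_norm_linePt k _)) _
    rw [abs_mul, abs_neg, abs_of_pos Real.two_pi_pos, Real.norm_eq_abs]
    nlinarith [Real.two_le_pi, abs_nonneg ξ]
  · rw [mellinWeight_eq, ← ENNReal.ofReal_coe_nnreal, hA, mul_zero]
    refine ENNReal.ofReal_le_ofReal ((profile_le_pow hε (norm_nonneg _)).trans ?_)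
    exact pow_le_pow_left₀ (norm_nonneg _) (norm_linePt_zero_le k) _

/-! ### The norms in logarithmic coordinates -/

/-- The exponent `3k - 1/2`. -/
noncomputable def lineRe (k : ℕ) : ℝ := 3 * (k : ℝ) - 1 / 2

theorem lineRe_lt (k : ℕ) : lineRe k < ((3 * k : ℕ) : ℝ) := by
  rw [lineRe]; push_cast; linarith

/-- The Schwartz function attached to a test function vanishing to order `3k`. -/
noncomputable abbrev IsFlat.toS (hf : IsFlat (3 * k) f) : 𝓢(ℝ, ℂ) := hf.lift (lineRe_lt k)

theorem IsFlat.mellinHat_eq (hf : IsFlat (3 * k) f) (s : ℝ) :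
    mellinHat f (linePt k s) = 𝓕 hf.toS (-s / (2 * Real.pi)) := by
  have e : (fun u : ℝ => (Real.exp (-(-linePt k s).re * u) • ((f (Real.exp (-u)) : ℝ) : ℂ)))
      = hf.toS := by
    ext u
    rw [IsFlat.lift_apply, logLift]
    simp [linePt, lineRe]
  rw [mellinHat, mellin_eq_fourier, SchwartzMap.fourier_coe, e]
  simp [linePt]

theorem lintegral_comp_mul_left_real (G : ℝ → ℝ≥0∞) {a : ℝ} (ha : a ≠ 0) :
    ∫⁻ x, G x = ENNReal.ofReal |a| * ∫⁻ x, G (a * x) := by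
  conv_lhs => rw [← Real.smul_map_volume_mul_left ha]
  rw [lintegral_smul_measure]
  congr 1
  exact lintegral_map_equiv G (Homeomorph.mulLeft₀ a ha).toMeasurableEquiv

/-- Substituting `s = -2πξ` produces a Jacobian `2π`, which cancels the normalising constant. -/
theorem IsFlat.homNorm_eq (hf : IsFlat (3 * k) f) (hε : 0 ≤ ε) :
    homNorm k ε f = wq (mellinWeight k ε) hf.toS ^ (1 / 2 : ℝ) := by
  have h2 : (2 * Real.pi) ≠ 0 := Real.two_pi_pos.ne'
  rw [homNorm, eLpNorm_eq_lintegral_rpow_enorm_toReal (by norm_num) (by norm_num)]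
  simp only [ENNReal.toReal_ofNat, ENNReal.rpow_ofNat]
  rw [lintegral_comp_mul_left_real _ (neg_ne_zero.2 h2), ENNReal.mul_rpow_of_nonneg _ _ (by norm_num),
    abs_neg, abs_of_pos Real.two_pi_pos, ENNReal.ofReal_rpow_of_pos Real.two_pi_pos,
    ← Real.sqrt_eq_rpow, ← mul_assoc, ← ENNReal.ofReal_mul (by positivity),
    inv_mul_cancel₀ (by positivity), ENNReal.ofReal_one, one_mul, wq]
  congr 1
  refine lintegral_congr fun ξ => ?_
  rw [enorm_mul, hf.mellinHat_eq]
  congr 3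
  · rw [← ofReal_norm, Complex.norm_real, Real.norm_eq_abs, abs_of_nonneg, mellinWeight]
    exact profile_nonneg hε (norm_nonneg _)
  · rw [neg_mul, neg_neg, mul_div_cancel_left₀ _ h2]

theorem lintegral_Ioi_eq_lintegral_exp_neg (G : ℝ → ℝ≥0∞) :
    ∫⁻ x in Ioi 0, G x = ∫⁻ u, ENNReal.ofReal (Real.exp (-u)) * G (Real.exp (-u)) := by
  have h := lintegral_image_eq_lintegral_abs_deriv_mul (s := univ) (f := fun u => Real.exp (-u))
    (f' := fun u => -Real.exp (-u)) MeasurableSet.univ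
    (fun u _ => (by simpa using (hasDerivAt_neg u).exp : HasDerivAt (fun u => Real.exp (-u)) _ u
      ).hasDerivWithinAt)
    (fun x _ y _ hxy => by simpa using hxy) G
  have himg : (fun u => Real.exp (-u)) '' univ = Ioi 0 := by
    rw [image_univ]
    ext x
    simp only [mem_range, mem_Ioi]
    exact ⟨fun ⟨y, hy⟩ => hy ▸ Real.exp_pos _, fun hx => ⟨-Real.log x, by simp [Real.exp_log hx]⟩⟩
  rw [himg] at h
  simpa [abs_neg, abs_of_pos (Real.exp_pos _)] using h

theorem IsFlat.eLpNorm_eq (hf : IsFlat (3 * k) f) :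
    eLpNorm f 2 (volume.restrict (Ioi 0)) = lq (lineRe k) hf.toS ^ (1 / 2 : ℝ) := by
  rw [eLpNorm_eq_lintegral_rpow_enorm_toReal (by norm_num) (by norm_num)]
  simp only [ENNReal.toReal_ofNat, ENNReal.rpow_ofNat]
  rw [lintegral_Ioi_eq_lintegral_exp_neg, lq]
  congr 1
  refine lintegral_congr fun u => ?_
  rw [IsFlat.lift_apply, logLift, enorm_ofReal_sq, mul_pow, ENNReal.ofReal_mul (by positivity),
    ← mul_assoc, ← ENNReal.ofReal_mul (by positivity), ← Real.exp_nat_mul, ← Real.exp_add,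
    ← sq_abs (f _), ENNReal.ofReal_pow (abs_nonneg _), ← Real.norm_eq_abs, ofReal_norm]
  congr 3
  push_cast
  ring

theorem IsFlat.testNorm_eq (hf : IsFlat (3 * k) f) (ε : ℝ) (ζ : ℝ → ℝ) :
    testNorm k ε ζ f = eLpNorm f 2 (volume.restrict (Ioi 0)) + homNorm k ε f := by
  rw [testNorm, hf.polyNorm_eq_zero, hf.remainder_eq_self, ENNReal.ofReal_zero, zero_add]

theorem sq_rpow_half (a : ℝ≥0∞) : (a ^ (1 / 2 : ℝ)) ^ 2 = a := by
  rw [← ENNReal.rpow_natCast, ← ENNReal.rpow_mul]; norm_num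

theorem rpow_half_le_of_sq_le {a b : ℝ≥0∞} (h : a ≤ b ^ 2) : a ^ (1 / 2 : ℝ) ≤ b := by
  rw [← sq_rpow_half a] at h
  exact (ENNReal.pow_le_pow_left_iff (by norm_num)).1 h

theorem IsFlat.lq_add_wq_le (hf : IsFlat (3 * k) f) (hε : 0 ≤ ε) (ζ : ℝ → ℝ) :
    lq (lineRe k) hf.toS + wq (mellinWeight k ε) hf.toS ≤ testNorm k ε ζ f ^ 2 := by
  rw [hf.testNorm_eq, hf.eLpNorm_eq, hf.homNorm_eq hε]
  conv_lhs => rw [← sq_rpow_half (lq _ _), ← sq_rpow_half (wq _ _)]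
  rw [add_sq]
  exact add_le_add_left le_self_add _

theorem two_mul_lineRe (k : ℕ) : 2 * lineRe k = 2 * ((3 * k : ℕ) : ℝ) - 1 := by
  rw [lineRe]; push_cast; ring

/-! ### `testNorm` is a finite seminorm on test functions -/

theorem IsTest.aestronglyMeasurable (hf : IsTest f) :
    AEStronglyMeasurable f (volume.restrict (Ioi 0)) :=
  (hf.smooth.continuousOn.mono Ioi_subset_Ici_self).aestronglyMeasurable measurableSet_Ioi

theorem polyNorm_eq_norm (k : ℕ) (f : ℝ → ℝ) :
    polyNorm k f = ‖WithLp.toLp 2 fun i : Fin (3 * k) => taylorCoeff f i‖ := by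
  rw [EuclideanSpace.norm_eq, polyNorm, Finset.sum_range]
  simp

theorem IsTest.polyNorm_add_le (hf : IsTest f) (hg : IsTest g) (k : ℕ) :
    polyNorm k (fun x => f x + g x) ≤ polyNorm k f + polyNorm k g := by
  simp only [polyNorm_eq_norm, hf.taylorCoeff_add hg]
  exact norm_add_le (WithLp.toLp 2 fun i : Fin (3 * k) => taylorCoeff f i)
    (WithLp.toLp 2 fun i : Fin (3 * k) => taylorCoeff g i)

theorem polyNorm_const_mul (c : ℝ) (k : ℕ) (f : ℝ → ℝ) :
    polyNorm k (fun x => c * f x) = |c| * polyNorm k f := by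
  simp only [polyNorm, taylorCoeff_const_mul, mul_pow, ← Finset.mul_sum]
  rw [Real.sqrt_mul (sq_nonneg c), Real.sqrt_sq_eq_abs]

theorem abs_taylorCoeff_le_polyNorm {i : ℕ} (hi : i < 3 * k) (f : ℝ → ℝ) :
    |taylorCoeff f i| ≤ polyNorm k f := by
  rw [polyNorm_eq_norm]
  exact PiLp.norm_apply_le (WithLp.toLp 2 fun i : Fin (3 * k) => taylorCoeff f i) ⟨i, hi⟩

/-- Additivity of the transform needs convergent integrals. Flatness provides Schwartz lifts, where
the Fourier transform is linear and Minkowski applies. -/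
theorem IsFlat.homNorm_add_le (hf : IsFlat (3 * k) f) (hg : IsFlat (3 * k) g) (hk : 1 ≤ k)
    (hε : 0 ≤ ε) (hε1 : ε ≤ 1) :
    homNorm k ε (fun x => f x + g x) ≤ homNorm k ε f + homNorm k ε g := by
  have hfg : IsFlat (3 * k) fun x => f x + g x := by
    simpa [sub_eq_add_neg] using hf.sub (hg.const_mul (-1))
  have hw := (isWeight_mellinWeight hk hε hε1).meas
  rw [hf.homNorm_eq hε, hg.homNorm_eq hε, hfg.homNorm_eq hε]
  have e : hfg.toS = hf.toS + hg.toS := by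
    ext u
    simp only [add_apply, IsFlat.lift_apply, logLift]
    push_cast
    ring
  have key := ENNReal.lintegral_Lp_add_le (μ := volume) (p := 2)
    (f := fun ξ => mellinWeight k ε ξ * ‖𝓕 hf.toS ξ‖ₑ)
    (g := fun ξ => mellinWeight k ε ξ * ‖𝓕 hg.toS ξ‖ₑ) (by fun_prop) (by fun_prop) (by norm_num)
  simp only [ENNReal.rpow_ofNat, Pi.add_apply] at key
  refine le_trans ?_ key
  rw [wq, e, FourierTransform.fourier_add]
  gcongr with ξ
  rw [← mul_add]
  gcongr
  exact enorm_add_le _ _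

theorem mellinHat_const_mul (c : ℝ) (f : ℝ → ℝ) (l : ℂ) :
    mellinHat (fun x => c * f x) l = c * mellinHat f l := by
  simp only [mellinHat, Complex.ofReal_mul]
  exact mellin_const_smul (fun x => (f x : ℂ)) (-l) (c : ℂ)

theorem homNorm_const_mul (c : ℝ) (k : ℕ) (ε : ℝ) (f : ℝ → ℝ) :
    homNorm k ε (fun x => c * f x) = ‖c‖ₑ * homNorm k ε f := by
  simp only [homNorm, mellinHat_const_mul]
  have e : (fun s : ℝ => ((‖linePt k s‖ ^ (3 * k + 1) * mu ε (linePt k s) ^ k : ℝ) : ℂ) *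
      ((c : ℂ) * mellinHat f (linePt k s))) = (c : ℂ) • fun s : ℝ =>
      ((‖linePt k s‖ ^ (3 * k + 1) * mu ε (linePt k s) ^ k : ℝ) : ℂ) * mellinHat f (linePt k s) := by
    ext s
    simp only [Pi.smul_apply, smul_eq_mul]
    ring
  have hc : ‖(c : ℂ)‖ₑ = ‖c‖ₑ := by rw [← ofReal_norm, Complex.norm_real, ofReal_norm]
  rw [e, eLpNorm_const_smul, hc]
  ring

theorem testNorm_const_mul (c : ℝ) (k : ℕ) (ε : ℝ) (ζ f : ℝ → ℝ) :
    testNorm k ε ζ (fun x => c * f x) = ‖c‖ₑ * testNorm k ε ζ f := by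
  rw [testNorm, testNorm, remainder_const_mul, homNorm_const_mul, polyNorm_const_mul,
    ENNReal.ofReal_mul (abs_nonneg c), ← Real.norm_eq_abs, ofReal_norm, mul_add, mul_add]
  congr 2
  exact eLpNorm_const_smul c (remainder k ζ f) 2 (volume.restrict (Ioi 0))

theorem testNorm_add_le (hk : 1 ≤ k) (hε : 0 ≤ ε) (hε1 : ε ≤ 1) (hζ : IsCutoff ζ)
    (hf : IsTest f) (hg : IsTest g) :
    testNorm k ε ζ (fun x => f x + g x) ≤ testNorm k ε ζ f + testNorm k ε ζ g := by
  have h1 : ENNReal.ofReal (polyNorm k fun x => f x + g x)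
      ≤ ENNReal.ofReal (polyNorm k f) + ENNReal.ofReal (polyNorm k g) := by
    rw [← ENNReal.ofReal_add (p := polyNorm k f) (q := polyNorm k g) (Real.sqrt_nonneg _) (Real.sqrt_nonneg _)]
    exact ENNReal.ofReal_le_ofReal (hf.polyNorm_add_le hg k)
  have hf0 := isFlat_remainder (k := k) hζ hf
  have hg0 := isFlat_remainder (k := k) hζ hg
  have h2 := eLpNorm_add_le hf0.test.aestronglyMeasurable hg0.test.aestronglyMeasurable
    (p := 2) (by norm_num)
  have h3 := hf0.homNorm_add_le hg0 hk hε hε1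
  rw [testNorm, testNorm, testNorm, hf.remainder_add hg]
  calc _ ≤ (ENNReal.ofReal (polyNorm k f) + ENNReal.ofReal (polyNorm k g))
        + (eLpNorm (remainder k ζ f) 2 (volume.restrict (Ioi 0))
          + eLpNorm (remainder k ζ g) 2 (volume.restrict (Ioi 0)))
        + (homNorm k ε (remainder k ζ f) + homNorm k ε (remainder k ζ g)) :=
        add_le_add (add_le_add h1 h2) h3
    _ = _ := by ring

theorem testNorm_sum_le (hk : 1 ≤ k) (hε : 0 ≤ ε) (hε1 : ε ≤ 1) (hζ : IsCutoff ζ) {ι : Type*}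
    (s : Finset ι) {F : ι → ℝ → ℝ} (hF : ∀ i ∈ s, IsTest (F i)) :
    testNorm k ε ζ (fun x => ∑ i ∈ s, F i x) ≤ ∑ i ∈ s, testNorm k ε ζ (F i) := by
  classical
  induction s using Finset.induction_on with
  | empty => simpa using (testNorm_const_mul 0 k ε ζ fun _ => 0).le
  | insert a s ha ih =>
    simp only [Finset.sum_insert ha]
    refine (testNorm_add_le hk hε hε1 hζ (hF a (by simp))
      (IsTest.sum s fun i hi => hF i (by simp [hi]))).trans ?_
    gcongr
    exact ih fun i hi => hF i (by simp [hi])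

theorem testNorm_remainder_le (hζ : IsCutoff ζ) (hf : IsTest f) :
    testNorm k ε ζ (remainder k ζ f) ≤ testNorm k ε ζ f := by
  rw [(isFlat_remainder hζ hf).testNorm_eq, testNorm, add_assoc]
  exact le_add_self

theorem eLpNorm_lt_top_of_isFlat (hf : IsFlat (3 * k) f) : eLpNorm f 2 (volume.restrict (Ioi 0)) < ⊤ := by
  obtain ⟨C, hC⟩ := hf.test.exists_bound
  obtain ⟨R, hR⟩ := hf.test.eventually_zero
  have h1 : eLpNorm f 2 (volume.restrict (Ioi 0))
      ≤ eLpNorm (indicator (Icc 0 R) fun _ => C) 2 (volume.restrict (Ioi 0)) := by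
    refine eLpNorm_mono_ae ?_
    filter_upwards [ae_restrict_mem measurableSet_Ioi] with x hx
    rcases le_total x R with h | h
    · rw [indicator_of_mem (show x ∈ Icc 0 R from ⟨le_of_lt hx, h⟩)]
      exact (hC x (le_of_lt hx)).trans (le_abs_self C)
    · rw [hR x h, norm_zero]; exact norm_nonneg _
  refine h1.trans_lt (memLp_indicator_const 2 measurableSet_Icc C (Or.inr ?_)).2
  exact ((Measure.restrict_apply_le _ _).trans_lt measure_Icc_lt_top).ne

/-- The weight has a polynomial majorant independent of `ε`, so a fixed test function has norms
bounded uniformly in `ε`. -/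
theorem exists_testNorm_le (hk : 1 ≤ k) (hζ : IsCutoff ζ) (hf : IsTest f) :
    ∃ C : ℝ≥0, ∀ ε : ℝ, 0 ≤ ε → ε ≤ 1 → testNorm k ε ζ f ≤ C := by
  have hf0 := isFlat_remainder (k := k) hζ hf
  set A : ℝ≥0 := (3 * k + 3 : ℝ≥0) ^ (4 * k + 1)
  set K := (A : ℝ≥0∞) ^ 4 * ∫⁻ ξ, ((1 + ‖ξ‖ₑ) ^ (4 * k + 1) * ‖𝓕 hf0.toS ξ‖ₑ) ^ 2 with hK
  have h1 := (lintegral_pow_mul_enorm_sq_lt_top (4 * k + 1) (𝓕 hf0.toS)).ne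
  have hKt : K ≠ ⊤ := by finiteness
  have h2 := (eLpNorm_lt_top_of_isFlat hf0).ne
  have h3 : K ^ (1 / 2 : ℝ) ≠ ⊤ := by finiteness
  refine ⟨(ENNReal.ofReal (polyNorm k f) + eLpNorm (remainder k ζ f) 2 (volume.restrict (Ioi 0))
    + K ^ (1 / 2 : ℝ)).toNNReal, fun ε hε hε1 => ?_⟩
  rw [ENNReal.coe_toNNReal (by finiteness), testNorm]
  gcongr
  rw [hf0.homNorm_eq hε]
  gcongr
  exact (isWeight_mellinWeight hk hε hε1).wq_le hf0.toS

theorem testNorm_lt_top (hk : 1 ≤ k) (hε : 0 ≤ ε) (hε1 : ε ≤ 1) (hζ : IsCutoff ζ) (hf : IsTest f) :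
    testNorm k ε ζ f < ⊤ := by
  obtain ⟨C, hC⟩ := exists_testNorm_le hk hζ hf
  exact (hC ε hε hε1).trans_lt ENNReal.coe_lt_top

end

section

variable {f g h : ℝ → ℝ} {n k : ℕ} {ζ : ℝ → ℝ} {ε : ℝ}

/-! ### Products of test functions -/

theorem eLpNorm_mul_le {c : ℝ≥0} (hc : ∀ᵐ x ∂volume.restrict (Ioi (0 : ℝ)), ‖f x‖ₑ ≤ c)
    (g : ℝ → ℝ) :
    eLpNorm (fun x => f x * g x) 2 (volume.restrict (Ioi 0))
      ≤ c * eLpNorm g 2 (volume.restrict (Ioi 0)) := by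
  refine (eLpNorm_le_nnreal_smul_eLpNorm_of_ae_le_mul (c := c) ?_ 2)
  filter_upwards [hc] with x hx
  rw [nnnorm_mul]
  gcongr
  rw [enorm_eq_nnnorm] at hx
  exact_mod_cast hx

/-- Lets `C + 1` stand in for `√C` when square roots of quadratic estimates are taken. -/
theorem le_sq_succ (C : ℝ≥0) : (C : ℝ≥0∞) ≤ ((C + 1 : ℝ≥0) : ℝ≥0∞) ^ 2 := by
  have : C ≤ (C + 1) ^ 2 := by
    calc C ≤ (C + 1) * 1 := by simp
      _ ≤ (C + 1) * (C + 1) := by gcongr; simp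
      _ = _ := by ring
  exact_mod_cast this

/-- With `τ = -log x` one has `f(x) = e^(-στ) F(τ)`, and the local Wiener norm dominates `F(τ)`. -/
theorem exists_enorm_le_of_isFlat (hk : 1 ≤ k) (ζ : ℝ → ℝ) :
    ∃ C : ℝ≥0, ∀ ε : ℝ, 0 ≤ ε → ε ≤ 1 → ∀ f, IsFlat (3 * k) f → ∀ x, 0 < x →
      ‖f x‖ₑ ≤ C * testNorm k ε ζ f := by
  obtain ⟨C, hC⟩ := exists_fourierL1_window_le ((3 * k + 3 : ℝ≥0) ^ (4 * k + 1)) (4 * k + 1)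
    (show 1 ≤ 3 * k by omega) (two_mul_lineRe k)
  refine ⟨C + 1, fun ε hε hε1 f hf x hx => ?_⟩
  have h1 := hC _ (isWeight_mellinWeight hk hε hε1) hf.toS (-Real.log x)
  have h2 := enorm_sq_le_fourierL1_window (lineRe k) (-Real.log x) hf.toS
  have h3 : ‖f x‖ₑ ^ 2 = ENNReal.ofReal (Real.exp (-2 * lineRe k * -Real.log x)) *
      ‖hf.toS (-Real.log x)‖ₑ ^ 2 := by
    rw [IsFlat.lift_apply, logLift, enorm_ofReal_sq, ← ENNReal.ofReal_mul (by positivity), mul_pow,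
      ← mul_assoc, ← Real.exp_nat_mul, ← Real.exp_add, neg_neg, Real.exp_log hx, ← ofReal_norm,
      ← ENNReal.ofReal_pow (norm_nonneg _), Real.norm_eq_abs, sq_abs]
    rw [show -2 * lineRe k * -Real.log x + ((2 : ℕ) : ℝ) * (lineRe k * -Real.log x) = 0 by
      push_cast; ring, Real.exp_zero, one_mul]
  refine (ENNReal.pow_le_pow_left_iff two_ne_zero).1 ?_
  calc ‖f x‖ₑ ^ 2 ≤ C * (lq (lineRe k) hf.toS + wq (mellinWeight k ε) hf.toS) := by
        rw [h3]; exact le_trans (by gcongr) h1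
    _ ≤ ((C + 1 : ℝ≥0) : ℝ≥0∞) ^ 2 * testNorm k ε ζ f ^ 2 :=
        mul_le_mul' (le_sq_succ C) (hf.lq_add_wq_le hε ζ)
    _ = _ := by ring

theorem exists_testNorm_mul_le_of_isFlat (hk : 1 ≤ k) (hζ : IsCutoff ζ) :
    ∃ C : ℝ≥0, ∀ ε : ℝ, 0 ≤ ε → ε ≤ 1 → ∀ f g, IsFlat (3 * k) f → IsFlat (3 * k) g →
      testNorm k ε ζ (fun x => f x * g x) ≤ C * (testNorm k ε ζ f * testNorm k ε ζ g) := by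
  obtain ⟨C₁, hC₁⟩ := exists_enorm_le_of_isFlat hk ζ
  obtain ⟨C₂, hC₂⟩ := exists_wq_mul_le ((3 * k + 3 : ℝ≥0) ^ (4 * k + 1)) (4 * k + 1)
    (show 1 ≤ 3 * k by omega) (two_mul_lineRe k)
  refine ⟨C₁ + (2 * C₂ + 1), fun ε hε hε1 f g hf hg => ?_⟩
  have hfg := hf.mul hg.test
  set Tf := testNorm k ε ζ f with hTf
  set Tg := testNorm k ε ζ g with hTg
  have hft : Tf ≠ ⊤ := (testNorm_lt_top hk hε hε1 hζ hf.test).ne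
  have hgL : eLpNorm g 2 (volume.restrict (Ioi 0)) ≤ Tg := by
    rw [hTg, hg.testNorm_eq]; exact le_self_add
  have hL : eLpNorm (fun x => f x * g x) 2 (volume.restrict (Ioi 0)) ≤ C₁ * (Tf * Tg) := by
    refine (eLpNorm_mul_le (c := C₁ * Tf.toNNReal) ?_ g).trans ?_
    · filter_upwards [ae_restrict_mem measurableSet_Ioi] with x hx
      rw [ENNReal.coe_mul, ENNReal.coe_toNNReal hft]
      exact hC₁ ε hε hε1 f hf x hx
    · rw [ENNReal.coe_mul, ENNReal.coe_toNNReal hft, mul_assoc]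
      gcongr
  have hH : homNorm k ε (fun x => f x * g x) ≤ ((2 * C₂ + 1 : ℝ≥0) : ℝ≥0∞) * (Tf * Tg) := by
    rw [hfg.homNorm_eq hε]
    refine rpow_half_le_of_sq_le ?_
    have bf := hf.lq_add_wq_le hε ζ
    have bg := hg.lq_add_wq_le hε ζ
    refine (hC₂ _ (isWeight_mellinWeight hk hε hε1) hf.toS hg.toS hfg.toS fun u => ?_).trans ?_
    · simp only [IsFlat.lift_apply, logLift]
      have e : Real.exp (lineRe k * u) = Real.exp (-lineRe k * u) *
          (Real.exp (lineRe k * u) * Real.exp (lineRe k * u)) := by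
        rw [← Real.exp_add, ← Real.exp_add]; congr 1; ring
      have e' := congrArg (fun x : ℝ => (x : ℂ)) e
      push_cast at e' ⊢
      linear_combination (f (Real.exp (-u)) : ℂ) * g (Real.exp (-u)) * e'
    · calc _ ≤ (C₂ : ℝ≥0∞) * (Tf ^ 2 * Tg ^ 2 + Tg ^ 2 * Tf ^ 2) := by
            gcongr
            · exact le_add_self.trans bg
            · exact le_add_self.trans bf
        _ = ((2 * C₂ : ℝ≥0) : ℝ≥0∞) * (Tf * Tg) ^ 2 := by push_cast; ring
        _ ≤ ((2 * C₂ + 1 : ℝ≥0) : ℝ≥0∞) ^ 2 * (Tf * Tg) ^ 2 := by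
            gcongr; exact le_sq_succ _
        _ = _ := by rw [← mul_pow]
  rw [hfg.testNorm_eq, ENNReal.coe_add, add_mul]
  exact add_le_add hL hH

/-- The factor `q` is lifted with exponent `0`. Its lift tends to `q(0)` as `u → +∞`, so it is only
a bounded multiplier with bounded derivatives. -/
theorem exists_testNorm_mul_test_le (hk : 1 ≤ k) (ζ : ℝ → ℝ) {q : ℝ → ℝ} (hq : IsTest q) :
    ∃ C : ℝ≥0, ∀ ε : ℝ, 0 ≤ ε → ε ≤ 1 → ∀ f, IsFlat (3 * k) f →
      testNorm k ε ζ (fun x => f x * q x) ≤ C * testNorm k ε ζ f := by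
  obtain ⟨C₁, hC₁⟩ := hq.exists_bound
  obtain ⟨C₂, hC₂⟩ := exists_wq_multiplier_le ((3 * k + 3 : ℝ≥0) ^ (4 * k + 1)) (4 * k + 1)
    (hq.contDiff_logLift 0) hq.exists_iteratedDeriv_logLift_bound
  refine ⟨C₁.toNNReal + (C₂ + 1), fun ε hε hε1 f hf => ?_⟩
  have hfq := hf.mul hq
  set Tf := testNorm k ε ζ f with hTf
  have hL : eLpNorm (fun x => f x * q x) 2 (volume.restrict (Ioi 0)) ≤ C₁.toNNReal * Tf := by
    simp_rw [mul_comm (f _)]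
    refine (eLpNorm_mul_le (c := C₁.toNNReal) ?_ f).trans ?_
    · filter_upwards [ae_restrict_mem measurableSet_Ioi] with x hx
      rw [← ofReal_norm]
      exact ENNReal.ofReal_le_ofReal (hC₁ x (le_of_lt hx))
    · gcongr
      rw [hTf, hf.testNorm_eq]; exact le_self_add
  have hH : homNorm k ε (fun x => f x * q x) ≤ ((C₂ + 1 : ℝ≥0) : ℝ≥0∞) * Tf := by
    rw [hfq.homNorm_eq hε]
    refine rpow_half_le_of_sq_le ?_
    refine (hC₂ _ _ (isWeight_mellinWeight hk hε hε1) hf.toS hfq.toS fun u => ?_).trans ?_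
    · simp only [IsFlat.lift_apply, logLift]
      push_cast
      simp only [zero_mul, Complex.exp_zero, one_mul]
      ring
    · rw [mul_pow]
      exact mul_le_mul' (le_sq_succ C₂) (le_add_self.trans (hf.lq_add_wq_le hε ζ))
  rw [hfq.testNorm_eq, ENNReal.coe_add, add_mul]
  exact add_le_add hL hH

/-! ### From flat functions to all test functions -/

theorem enorm_taylorCoeff_le {i : ℕ} (hi : i < 3 * k) (ε : ℝ) (ζ f : ℝ → ℝ) :
    ‖taylorCoeff f i‖ₑ ≤ testNorm k ε ζ f := by
  rw [testNorm, add_assoc]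
  refine le_trans ?_ le_self_add
  rw [← ofReal_norm]
  exact ENNReal.ofReal_le_ofReal (abs_taylorCoeff_le_polyNorm hi f)

theorem testNorm_sum_mul_le (hk : 1 ≤ k) (hε : 0 ≤ ε) (hε1 : ε ≤ 1) (hζ : IsCutoff ζ) {ι : Type*}
    (s : Finset ι) (c : ι → ℝ) {F : ι → ℝ → ℝ} (hF : ∀ i ∈ s, IsTest (F i)) :
    testNorm k ε ζ (fun x => ∑ i ∈ s, c i * F i x) ≤ ∑ i ∈ s, ‖c i‖ₑ * testNorm k ε ζ (F i) := by
  refine (testNorm_sum_le hk hε hε1 hζ s fun i hi => (hF i hi).const_mul (c i)).trans (le_of_eq ?_)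
  simp_rw [testNorm_const_mul]

theorem eq_remainder_add (k : ℕ) (ζ f : ℝ → ℝ) (x : ℝ) : f x = remainder k ζ f x +
    ∑ i ∈ Finset.range (3 * k), taylorCoeff f i * (ζ x * x ^ i) := by
  rw [remainder_eq]; ring

theorem exists_enorm_le (hk : 1 ≤ k) (hζ : IsCutoff ζ) :
    ∃ C : ℝ≥0, ∀ ε : ℝ, 0 ≤ ε → ε ≤ 1 → ∀ f, IsTest f → ∀ x, 0 < x →
      ‖f x‖ₑ ≤ C * testNorm k ε ζ f := by
  obtain ⟨C, hC⟩ := exists_enorm_le_of_isFlat hk ζ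
  choose D hD using fun i => (hζ.isTest_mul_pow i).exists_bound
  refine ⟨C + ∑ i ∈ Finset.range (3 * k), (D i).toNNReal, fun ε hε hε1 f hf x hx => ?_⟩
  set T := testNorm k ε ζ f with hT
  have h1 : ‖remainder k ζ f x‖ₑ ≤ C * T :=
    (hC ε hε hε1 _ (isFlat_remainder hζ hf) x hx).trans (by
      gcongr; exact testNorm_remainder_le hζ hf)
  have h2 : ‖∑ i ∈ Finset.range (3 * k), taylorCoeff f i * (ζ x * x ^ i)‖ₑ
      ≤ ∑ i ∈ Finset.range (3 * k), (D i).toNNReal * T := by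
    refine (enorm_sum_le _ _).trans (Finset.sum_le_sum fun i hi => ?_)
    rw [enorm_mul, mul_comm]
    refine mul_le_mul' ?_ (enorm_taylorCoeff_le (Finset.mem_range.1 hi) ε ζ f)
    rw [← ofReal_norm]
    exact ENNReal.ofReal_le_ofReal (hD i x hx.le)
  conv_lhs => rw [eq_remainder_add k ζ f x]
  refine (enorm_add_le _ _).trans ((add_le_add h1 h2).trans (le_of_eq ?_))
  rw [← Finset.sum_mul, ENNReal.coe_add, add_mul, ENNReal.ofNNReal_finsetSum]

/-- Expand both factors into remainder and Taylor part: flat times flat, two mixed sums treated by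
multipliers, and a finite combination of fixed functions whose coefficients are controlled by the
norms. -/
theorem exists_testNorm_mul_le (hk : 1 ≤ k) (hζ : IsCutoff ζ) :
    ∃ C : ℝ≥0, ∀ ε : ℝ, 0 ≤ ε → ε ≤ 1 → ∀ f g, IsTest f → IsTest g →
      testNorm k ε ζ (fun x => f x * g x) ≤ C * (testNorm k ε ζ f * testNorm k ε ζ g) := by
  obtain ⟨C, hC⟩ := exists_testNorm_mul_le_of_isFlat hk hζ
  choose D hD using fun i => exists_testNorm_mul_test_le hk ζ (hζ.isTest_mul_pow i)
  choose E hE using fun i j =>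
    exists_testNorm_le hk hζ ((hζ.isTest_mul_pow i).mul (hζ.isTest_mul_pow j))
  set S := Finset.range (3 * k) with hS
  refine ⟨C + (∑ j ∈ S, D j + (∑ i ∈ S, D i + ∑ i ∈ S, ∑ j ∈ S, E i j)),
    fun ε hε hε1 f g hf hg => ?_⟩
  have hf0 := isFlat_remainder (k := k) hζ hf
  have hg0 := isFlat_remainder (k := k) hζ hg
  set f₀ := remainder k ζ f with hf₀
  set g₀ := remainder k ζ g with hg₀
  set Tf := testNorm k ε ζ f with hTf
  set Tg := testNorm k ε ζ g with hTg
  have hf0T : testNorm k ε ζ f₀ ≤ Tf := testNorm_remainder_le hζ hf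
  have hg0T : testNorm k ε ζ g₀ ≤ Tg := testNorm_remainder_le hζ hg
  have ha : ∀ i ∈ S, ‖taylorCoeff f i‖ₑ ≤ Tf :=
    fun i hi => enorm_taylorCoeff_le (Finset.mem_range.1 hi) ε ζ f
  have hb : ∀ i ∈ S, ‖taylorCoeff g i‖ₑ ≤ Tg :=
    fun i hi => enorm_taylorCoeff_le (Finset.mem_range.1 hi) ε ζ g
  have e : (fun x => f x * g x) = fun x => f₀ x * g₀ x +
      (∑ j ∈ S, taylorCoeff g j * (f₀ x * (ζ x * x ^ j)) +
        (∑ i ∈ S, taylorCoeff f i * (g₀ x * (ζ x * x ^ i)) +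
          ∑ i ∈ S, taylorCoeff f i *
            ∑ j ∈ S, taylorCoeff g j * ((ζ x * x ^ i) * (ζ x * x ^ j)))) := by
    ext x
    have e1 : ∑ j ∈ S, taylorCoeff g j * (f₀ x * (ζ x * x ^ j))
        = f₀ x * ∑ j ∈ S, taylorCoeff g j * (ζ x * x ^ j) := by
      rw [Finset.mul_sum]; exact Finset.sum_congr rfl fun j _ => by ring
    have e2 : ∑ i ∈ S, taylorCoeff f i * (g₀ x * (ζ x * x ^ i))
        = g₀ x * ∑ i ∈ S, taylorCoeff f i * (ζ x * x ^ i) := by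
      rw [Finset.mul_sum]; exact Finset.sum_congr rfl fun j _ => by ring
    have e3 : ∑ i ∈ S, taylorCoeff f i *
        ∑ j ∈ S, taylorCoeff g j * ((ζ x * x ^ i) * (ζ x * x ^ j))
        = (∑ i ∈ S, taylorCoeff f i * (ζ x * x ^ i)) *
          ∑ j ∈ S, taylorCoeff g j * (ζ x * x ^ j) := by
      rw [Finset.sum_mul]
      refine Finset.sum_congr rfl fun i _ => ?_
      rw [mul_assoc]
      congr 1
      rw [Finset.mul_sum]
      exact Finset.sum_congr rfl fun j _ => by ring
    rw [e1, e2, e3]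
    conv_lhs => rw [eq_remainder_add k ζ f x, eq_remainder_add k ζ g x]
    ring
  have t2 : ∀ j ∈ S, IsTest fun x => f₀ x * (ζ x * x ^ j) :=
    fun j _ => hf0.test.mul (hζ.isTest_mul_pow j)
  have t3 : ∀ i ∈ S, IsTest fun x => g₀ x * (ζ x * x ^ i) :=
    fun i _ => hg0.test.mul (hζ.isTest_mul_pow i)
  have t4 : ∀ i, ∀ j ∈ S, IsTest fun x => (ζ x * x ^ i) * (ζ x * x ^ j) :=
    fun i j _ => (hζ.isTest_mul_pow i).mul (hζ.isTest_mul_pow j)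
  have t4' : ∀ i ∈ S, IsTest fun x =>
      ∑ j ∈ S, taylorCoeff g j * ((ζ x * x ^ i) * (ζ x * x ^ j)) :=
    fun i _ => IsTest.sum S fun j hj => (t4 i j hj).const_mul _
  have T2 := IsTest.sum S fun j hj => (t2 j hj).const_mul (taylorCoeff g j)
  have T3 := IsTest.sum S fun i hi => (t3 i hi).const_mul (taylorCoeff f i)
  have T4 := IsTest.sum S fun i hi => (t4' i hi).const_mul (taylorCoeff f i)
  have b1 : testNorm k ε ζ (fun x => f₀ x * g₀ x) ≤ C * (Tf * Tg) :=
    (hC ε hε hε1 _ _ hf0 hg0).trans (by gcongr)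
  have b2 : testNorm k ε ζ (fun x => ∑ j ∈ S, taylorCoeff g j * (f₀ x * (ζ x * x ^ j)))
      ≤ ∑ j ∈ S, (D j : ℝ≥0∞) * (Tf * Tg) := by
    refine (testNorm_sum_mul_le hk hε hε1 hζ S _ t2).trans (Finset.sum_le_sum fun j hj => ?_)
    calc _ ≤ Tg * (D j * Tf) :=
          mul_le_mul' (hb j hj) ((hD j ε hε hε1 _ hf0).trans (by gcongr))
      _ = _ := by ring
  have b3 : testNorm k ε ζ (fun x => ∑ i ∈ S, taylorCoeff f i * (g₀ x * (ζ x * x ^ i)))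
      ≤ ∑ i ∈ S, (D i : ℝ≥0∞) * (Tf * Tg) := by
    refine (testNorm_sum_mul_le hk hε hε1 hζ S _ t3).trans (Finset.sum_le_sum fun i hi => ?_)
    calc _ ≤ Tf * (D i * Tg) :=
          mul_le_mul' (ha i hi) ((hD i ε hε hε1 _ hg0).trans (by gcongr))
      _ = _ := by ring
  have b4 : testNorm k ε ζ (fun x => ∑ i ∈ S, taylorCoeff f i *
      ∑ j ∈ S, taylorCoeff g j * ((ζ x * x ^ i) * (ζ x * x ^ j)))
      ≤ ∑ i ∈ S, ∑ j ∈ S, (E i j : ℝ≥0∞) * (Tf * Tg) := by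
    refine (testNorm_sum_mul_le hk hε hε1 hζ S _ t4').trans (Finset.sum_le_sum fun i hi => ?_)
    calc _ ≤ Tf * ∑ j ∈ S, Tg * E i j := by
          refine mul_le_mul' (ha i hi) ((testNorm_sum_mul_le hk hε hε1 hζ S _ (t4 i)).trans
            (Finset.sum_le_sum fun j hj => mul_le_mul' (hb j hj) (hE i j ε hε hε1)))
      _ = _ := by
          rw [Finset.mul_sum]
          exact Finset.sum_congr rfl fun j _ => by ring
  rw [e]
  refine (testNorm_add_le hk hε hε1 hζ (hf0.test.mul hg0.test) (T2.add (T3.add T4))).trans ?_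
  refine (add_le_add b1 ((testNorm_add_le hk hε hε1 hζ T2 (T3.add T4)).trans
    (add_le_add b2 ((testNorm_add_le hk hε hε1 hζ T3 T4).trans (add_le_add b3 b4))))).trans
    (le_of_eq ?_)
  simp only [← Finset.sum_mul]
  push_cast
  ring

end

section

variable {f g : ℝ → ℝ} {k : ℕ} {ζ : ℝ → ℝ} {ε : ℝ} {φ γ : ℕ → ℝ → ℝ}

/-! ### The completion -/

theorem Approximates.exists_bound (hk : 1 ≤ k) (hε : 0 ≤ ε) (hε1 : ε ≤ 1) (hζ : IsCutoff ζ)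
    (hφ : Approximates k ε ζ φ f) : ∃ B : ℝ≥0, ∀ᶠ n in atTop, testNorm k ε ζ (φ n) ≤ B := by
  obtain ⟨N, hN⟩ := hφ.cauchy 1 one_pos
  have hf := testNorm_lt_top hk hε hε1 hζ (hφ.test N)
  refine ⟨(1 + testNorm k ε ζ (φ N)).toNNReal, ?_⟩
  rw [ENNReal.coe_toNNReal (by finiteness)]
  filter_upwards [eventually_ge_atTop N] with n hn
  have h := testNorm_add_le (k := k) hk hε hε1 hζ ((hφ.test n).sub (hφ.test N)) (hφ.test N)
  simp only [sub_add_cancel] at h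
  exact h.trans (by gcongr; exact hN n hn N le_rfl)

theorem Approximates.limsup_lt_top (hk : 1 ≤ k) (hε : 0 ≤ ε) (hε1 : ε ≤ 1) (hζ : IsCutoff ζ)
    (hφ : Approximates k ε ζ φ f) : limsup (fun n => testNorm k ε ζ (φ n)) atTop < ⊤ := by
  obtain ⟨B, hB⟩ := hφ.exists_bound hk hε hε1 hζ
  exact (limsup_le_of_le (by isBoundedDefault) hB).trans_lt ENNReal.coe_lt_top

/-- The sup bound holds uniformly along the sequence and reaches the limit through an almost
everywhere convergent subsequence. -/
theorem Approximates.exists_ae_bound (hk : 1 ≤ k) (hε : 0 ≤ ε) (hε1 : ε ≤ 1) (hζ : IsCutoff ζ)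
    (hf : AEStronglyMeasurable f (volume.restrict (Ioi 0))) (hφ : Approximates k ε ζ φ f) :
    ∃ B : ℝ≥0, (∀ᶠ n in atTop, ∀ x, 0 < x → ‖φ n x‖ₑ ≤ B) ∧
      ∀ᵐ x ∂volume.restrict (Ioi (0 : ℝ)), ‖f x‖ₑ ≤ B := by
  obtain ⟨C, hC⟩ := exists_enorm_le hk hζ
  obtain ⟨B, hB⟩ := hφ.exists_bound hk hε hε1 hζ
  have h1 : ∀ᶠ n in atTop, ∀ x, 0 < x → ‖φ n x‖ₑ ≤ ((C * B : ℝ≥0) : ℝ≥0∞) := by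
    filter_upwards [hB] with n hn x hx
    rw [ENNReal.coe_mul]
    exact (hC ε hε hε1 _ (hφ.test n) x hx).trans (by gcongr)
  refine ⟨C * B, h1, ?_⟩
  obtain ⟨ns, hns, h2⟩ := (tendstoInMeasure_of_tendsto_eLpNorm two_ne_zero
    (fun n => (hφ.test n).aestronglyMeasurable) hf hφ.tendsto).exists_seq_tendsto_ae
  filter_upwards [h2, ae_restrict_mem measurableSet_Ioi] with x hx hx0
  refine le_of_tendsto ((continuous_enorm.tendsto _).comp hx) ?_
  filter_upwards [hns.tendsto_atTop.eventually h1] with n hn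
  exact hn x hx0

theorem Approximates.mul (hk : 1 ≤ k) (hε : 0 ≤ ε) (hε1 : ε ≤ 1) (hζ : IsCutoff ζ)
    (hf : AEStronglyMeasurable f (volume.restrict (Ioi 0)))
    (hg : AEStronglyMeasurable g (volume.restrict (Ioi 0)))
    (hφ : Approximates k ε ζ φ f) (hγ : Approximates k ε ζ γ g) :
    Approximates k ε ζ (fun n x => φ n x * γ n x) (fun x => f x * g x) where
  test n := (hφ.test n).mul (hγ.test n)
  cauchy δ hδ := by
    obtain ⟨C, hC⟩ := exists_testNorm_mul_le hk hζ
    obtain ⟨B₁, hB₁⟩ := hφ.exists_bound hk hε hε1 hζ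
    obtain ⟨B₂, hB₂⟩ := hγ.exists_bound hk hε hε1 hζ
    obtain ⟨N₁, hN₁⟩ := eventually_atTop.1 hB₁
    obtain ⟨N₂, hN₂⟩ := eventually_atTop.1 hB₂
    -- The summand `1` keeps `K` nonzero, so that `K * (δ / K) = δ`.
    set K : ℝ≥0∞ := C * B₂ + C * B₁ + 1 with hK
    have hK0 : K ≠ 0 := by simp [hK]
    have hKt : K ≠ ⊤ := by finiteness
    have hδ' : 0 < δ / K := ENNReal.div_pos hδ.ne' hKt
    obtain ⟨N₃, hN₃⟩ := hφ.cauchy _ hδ'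
    obtain ⟨N₄, hN₄⟩ := hγ.cauchy _ hδ'
    refine ⟨max (max N₁ N₂) (max N₃ N₄), fun m hm n hn => ?_⟩
    simp only [ge_iff_le, max_le_iff] at hm hn
    have hd₁ := (hφ.test m).sub (hφ.test n)
    have hd₂ := (hγ.test m).sub (hγ.test n)
    have e : (fun x => φ m x * γ m x - φ n x * γ n x)
        = fun x => (φ m x - φ n x) * γ m x + φ n x * (γ m x - γ n x) := by ext x; ring
    rw [e]
    calc _ ≤ C * ((δ / K) * B₂) + C * (B₁ * (δ / K)) := by
          refine (testNorm_add_le hk hε hε1 hζ (hd₁.mul (hγ.test m)) ((hφ.test n).mul hd₂)).trans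
            (add_le_add ?_ ?_)
          · refine (hC ε hε hε1 _ _ hd₁ (hγ.test m)).trans ?_
            gcongr
            · exact hN₃ m hm.2.1 n hn.2.1
            · exact hN₂ m hm.1.2
          · refine (hC ε hε hε1 _ _ (hφ.test n) hd₂).trans ?_
            gcongr
            · exact hN₁ n hn.1.1
            · exact hN₄ m hm.2.2 n hn.2.2
      _ = (C * B₂ + C * B₁) * (δ / K) := by ring
      _ ≤ K * (δ / K) := by gcongr; exact le_self_add
      _ = δ := ENNReal.mul_div_cancel hK0 hKt
  tendsto := by
    -- In `φₙ (γₙ - g) + g (φₙ - f)` a bound is needed for the approximants of `f` but for the limit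
    -- `g`.
    obtain ⟨B₁, hB₁, -⟩ := hφ.exists_ae_bound hk hε hε1 hζ hf
    obtain ⟨B₂, -, hB₂⟩ := hγ.exists_ae_bound hk hε hε1 hζ hg
    have hlim : Tendsto (fun n =>
        (B₁ : ℝ≥0∞) * eLpNorm (fun x => γ n x - g x) 2 (volume.restrict (Ioi 0))
        + (B₂ : ℝ≥0∞) * eLpNorm (fun x => φ n x - f x) 2 (volume.restrict (Ioi 0)))
        atTop (𝓝 0) := by
      have h1 := ENNReal.Tendsto.const_mul hγ.tendsto (Or.inr (ENNReal.coe_ne_top (r := B₁)))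
      have h2 := ENNReal.Tendsto.const_mul hφ.tendsto (Or.inr (ENNReal.coe_ne_top (r := B₂)))
      simpa using h1.add h2
    refine tendsto_of_tendsto_of_tendsto_of_le_of_le' tendsto_const_nhds hlim
      (Eventually.of_forall fun n => zero_le) ?_
    filter_upwards [hB₁] with n hn
    have hφm := (hφ.test n).aestronglyMeasurable
    have hγm := (hγ.test n).aestronglyMeasurable
    have e : (fun x => φ n x * γ n x - f x * g x)
        = (fun x => φ n x * (γ n x - g x)) + fun x => g x * (φ n x - f x) := by
      ext x; simp only [Pi.add_apply]; ring
    rw [e]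
    refine (eLpNorm_add_le (hφm.mul (hγm.sub hg)) (hg.mul (hφm.sub hf)) (by norm_num)).trans
      (add_le_add ?_ ?_)
    · refine eLpNorm_mul_le ?_ _
      filter_upwards [ae_restrict_mem measurableSet_Ioi] with x hx
      exact hn x hx
    · exact eLpNorm_mul_le hB₂ _

theorem MemX.mul (hk : 1 ≤ k) (hε : 0 ≤ ε) (hε1 : ε ≤ 1) (hζ : IsCutoff ζ)
    (hf : MemX k ε ζ f) (hg : MemX k ε ζ g) : MemX k ε ζ fun x => f x * g x := by
  obtain ⟨hf2, φ, hφ⟩ := hf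
  obtain ⟨hg2, γ, hγ⟩ := hg
  obtain ⟨B, -, hB⟩ := hφ.exists_ae_bound hk hε hε1 hζ hf2.1
  exact ⟨⟨hf2.1.mul hg2.1, (eLpNorm_mul_le hB g).trans_lt
    (ENNReal.mul_lt_top ENNReal.coe_lt_top hg2.2)⟩, _, hφ.mul hk hε hε1 hζ hf2.1 hg2.1 hγ⟩

/-! ### The norm of the completion -/

theorem Approximates.XNorm_le (hφ : Approximates k ε ζ φ f) :
    XNorm k ε ζ f ≤ limsup (fun n => testNorm k ε ζ (φ n)) atTop :=
  iInf₂_le φ hφ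

theorem MemX.XNorm_lt_top (hk : 1 ≤ k) (hε : 0 ≤ ε) (hε1 : ε ≤ 1) (hζ : IsCutoff ζ)
    (hf : MemX k ε ζ f) : XNorm k ε ζ f < ⊤ := by
  obtain ⟨-, φ, hφ⟩ := hf
  exact hφ.XNorm_le.trans_lt (hφ.limsup_lt_top hk hε hε1 hζ)

/-- Passes an estimate valid for every approximating sequence to the infimum, so independence of the
limit from the sequence is never needed. Division by `b` excludes `b = 0`, where one sequence
suffices. -/
theorem MemX.le_mul_XNorm (hf : MemX k ε ζ f) {a b : ℝ≥0∞} (hb : b ≠ ⊤)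
    (h : ∀ φ, Approximates k ε ζ φ f → a ≤ b * limsup (fun n => testNorm k ε ζ (φ n)) atTop) :
    a ≤ b * XNorm k ε ζ f := by
  obtain ⟨-, φ, hφ⟩ := hf
  rcases eq_or_ne b 0 with rfl | hb0
  · simpa using h φ hφ
  · rw [mul_comm, ← ENNReal.div_le_iff hb0 hb]
    refine le_iInf₂ fun φ hφ => ?_
    rw [ENNReal.div_le_iff hb0 hb, mul_comm]
    exact h φ hφ

theorem limsup_mul_le_of_lt_top {u v : ℕ → ℝ≥0∞} (hu : limsup u atTop < ⊤)
    (hv : limsup v atTop < ⊤) :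
    limsup (fun n => u n * v n) atTop ≤ limsup u atTop * limsup v atTop :=
  ENNReal.limsup_mul_le' (Or.inr hv.ne) (Or.inl hu.ne)

theorem exists_XNorm_mul_le (hk : 1 ≤ k) (hζ : IsCutoff ζ) :
    ∃ C : ℝ≥0, ∀ ε : ℝ, 0 ≤ ε → ε ≤ 1 → ∀ f g : ℝ → ℝ, MemX k ε ζ f → MemX k ε ζ g →
      XNorm k ε ζ (fun x => f x * g x) ≤ (C : ℝ≥0∞) * XNorm k ε ζ f * XNorm k ε ζ g := by
  obtain ⟨C, hC⟩ := exists_testNorm_mul_le hk hζ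
  refine ⟨C, fun ε hε hε1 f g hf hg => ?_⟩
  have hft := (hf.XNorm_lt_top hk hε hε1 hζ).ne
  -- The infimum over sequences for `g` is taken with factor `C * XNorm k ε ζ f`, then the one for
  -- `f` with the limsup along `γ` fixed; both factors are finite.
  refine hg.le_mul_XNorm (by finiteness) fun γ hγ => ?_
  have hγt := (hγ.limsup_lt_top hk hε hε1 hζ).ne
  rw [mul_right_comm]
  refine hf.le_mul_XNorm (by finiteness) fun φ hφ => ?_
  have hφt := (hφ.limsup_lt_top hk hε hε1 hζ).ne
  refine (hφ.mul hk hε hε1 hζ hf.1.1 hg.1.1 hγ).XNorm_le.trans ?_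
  calc _ ≤ limsup (fun n => (C : ℝ≥0∞) * (testNorm k ε ζ (φ n) * testNorm k ε ζ (γ n))) atTop :=
        limsup_le_limsup (Eventually.of_forall fun n =>
          hC ε hε hε1 _ _ (hφ.test n) (hγ.test n)) (by isBoundedDefault) (by isBoundedDefault)
    _ = C * limsup (fun n => testNorm k ε ζ (φ n) * testNorm k ε ζ (γ n)) atTop :=
        ENNReal.limsup_const_mul_of_ne_top ENNReal.coe_ne_top
    _ ≤ C * (limsup (fun n => testNorm k ε ζ (φ n)) atTop
          * limsup (fun n => testNorm k ε ζ (γ n)) atTop) := by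
        gcongr
        exact limsup_mul_le_of_lt_top hφt.lt_top hγt.lt_top
    _ = _ := by ring

end

end WeightedX


theorem lemma5p4 (k : ℕ) (hk : 1 ≤ k) (ζ : ℝ → ℝ) (hζ : WeightedX.IsCutoff ζ) :
    ∃ C : ℝ≥0, ∀ ε : ℝ, 0 ≤ ε → ε ≤ 1 → ∀ f g : ℝ → ℝ,
      WeightedX.MemX k ε ζ f → WeightedX.MemX k ε ζ g →
        WeightedX.MemX k ε ζ (fun x => f x * g x) ∧
        WeightedX.XNorm k ε ζ (fun x => f x * g x) ≤
          (C : ℝ≥0∞) * WeightedX.XNorm k ε ζ f * WeightedX.XNorm k ε ζ g := by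
  obtain ⟨C, hC⟩ := WeightedX.exists_XNorm_mul_le hk hζ
  exact ⟨C, fun ε hε hε1 f g hf hg => ⟨hf.mul hk hε hε1 hζ hg, hC ε hε hε1 f g hf hg⟩⟩
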